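/- **Setting.** Let $n,m,s\ge 0$. Let $N=\mathbb C^{2n}\times T^*\mathbb R^m$ with points $x=(z_1,z_2,p,q)$, $z_1,z_2\in\mathbb C^n$, $p,q\in\mathbb R^m$, carry the canonical symplectic form $\omega_N$ in which $q$ and the imaginary parts of the complex coordinates are positions, and $p$ and their real parts the conjugate momenta: $$\omega_N(u,v)=\sum_{k=1}^{2}\sum_{j=1}^n \operatorname{Im}\big(u_{z_k^j}\overline{v_{z_k^j}}\big)+\sum_{i=1}^m\big(u_{q_i}v_{p_i}-u_{p_i}v_{q_i}\big).$$ The Hamiltonian vector field $X_K$ of $K$ is given by $\omega_N(X_K,\cdot)=\mathrm dK$. Let $P=\mathbb R^{3n}\times T^*\mathbb R^m$ with points $(w,p,q)$, $w=(w_1,\dots,w_n)$, $w_j\in\mathbb R^3$, carry the Poisson bracket $$\{f,g\}=\sum_{i=1}^m\Big(\frac{\partial f}{\partial q_i}\frac{\partial g}{\partial p_i}-\frac{\partial f}{\partial p_i}\frac{\partial g}{\partial q_i}\Big)+\sum_{j=1}^n\Big\langle w_j,\frac{\partial f}{\partial w_j}\times\frac{\partial g}{\partial w_j}\Big\rangle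 ,$$ whose symplectic leaves are the sets $\{\|w_j\|=r_j\ \text{for all } j\}$, $r_j\ge 0$. Let $M=S_2^n\times T^*\mathbb R^m\subset P$ be the leaf $\{\|w_j\|=1\ \text{for all } j\}$, with the symplectic form $\sum_i \mathrm dq_i\wedge \mathrm dp_i$ plus the sum of the area forms $(u,v)\mapsto\langle w_j,u_j\times v_j\rangle$ of the spheres. Let $\psi:N\to P$ be $\psi(z_1,z_2,p,q)=(J(z_1^1,z_2^1),\dots,J(z_1^n,z_2^n),p,q)$ with the Hopf map $$J(z_1,z_2)=\tfrac14\big(2\operatorname{Re}(z_1\bar z_2),\,2\operatorname{Im}(z_1\bar z_2),\,|z_1|^2-|z_2|^2\big).$$ **Method.** Take an $s$-stage partitioned Runge–Kutta method on $N$ with coefficients $(a^z,b^z)$ for $z=(z_1,z_2)$, $(a^p,b^p)$ for $p$ and $(a^q,b^q)$ for $q$. For a vector field $f$ on an open set $\Omega\subset N$ and a step size $h\in\mathbb R$, the stages $Y_1,\dots,Y_s\in\Omega$ and the update $\tilde x$ of $x$ are given, in each component $c\in\{z,p,q\}$, by $$Y_i^c=x^c+h\sum_j a^c_{ij}f^c(Y_j),\qquad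 \tilde x^c=x^c+h\sum_i b_i^cf^c(Y_i).$$ By an *integrator* for $f$ with step $h$ on a set $V$ we mean an update map $\Phi:V\to N$, $x\mapsto\tilde x$, defined by stages $Y_i=Y_i(x)\in\Omega$ that solve the stage equations, depend continuously on $x\in V$, and at which the linearization of the stage equations with respect to the stages is invertible. **Theorem.** Assume that the following hold for all $i,j$. * $z$ is integrated with a symplectic Runge–Kutta method: $b^z_ib^z_j=b^z_ia^z_{ij}+b^z_ja^z_{ji}$. * $(p,q)$ is integrated with a symplectic partitioned Runge–Kutta method: $b^p_ib^q_j=b^p_ia^q_{ij}+b^q_ja^p_{ji}$ and $b^p_i=b^q_i$. * The $b$-coefficients of the two methods coincide: $b^z_i=b^q_i$. Let $1\le r\le\infty$. 1. Let $K$ be a Hamiltonian of class $C^{r+1}$ on an open set $\Omega\subset N$, $h\in\mathbb R$, and $\Phi$ an integrator for $X_K$ with step $h$ on an open set $V\subset N$. Then $\Phi$ is of class $C^r$ and symplectic on $V$. 2. Let $H$ be a Hamiltonian of class $C^{r+1}$ on an open set $U\subset P$, and consider the pulled-back system $X_{H\circ\psi}$ on $\psi^{-1}(U)$. (a) For every compact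 $C\subset U$ and every $\varepsilon>0$ there is $h_0>0$ such that for all $|h|<h_0$ there are an open set $W\subset P$ containing $C$ and an integrator for $X_{H\circ\psi}$ with step $h$ on $\psi^{-1}(W)$ all of whose stages satisfy $\operatorname{dist}(Y_i(x),x)<\varepsilon$. (b) Let $h\in\mathbb R$, $W\subset P$ open, and let $\Phi$ be any integrator for $X_{H\circ\psi}$ with step $h$ on $\psi^{-1}(W)$ (symplectic by 1). Then $\Phi$ descends to a map $\varphi:W\to P$ with $\varphi\circ\psi=\psi\circ\Phi$ on $\psi^{-1}(W)$. The map $\varphi$ is of class $C^r$, is a Poisson map, and maps each point to a point of the same symplectic leaf of $P$. In particular $\varphi$ maps $M\cap W$ into $M$, and its restriction $M\cap W\to M$ is symplectic. -/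

import Mathlib

open scoped Matrix

noncomputable section

namespace CollectiveSymplectic

/-! ### The spaces `N`, `P`, `M` and the map `ψ : N → P` -/

/-- `N = ℂ²ⁿ × T*ℝᵐ`; a point is `(z₁, z₂, p, q)` with `z₁, z₂ ∈ ℂⁿ` and `p, q ∈ ℝᵐ`. -/
abbrev SpaceN (n m : ℕ) : Type :=
  (Fin n → ℂ) × (Fin n → ℂ) × (Fin m → ℝ) × (Fin m → ℝ)

/-- `P = ℝ³ⁿ × T*ℝᵐ`; a point is `(w, p, q)` with `w = (w₁, …, wₙ)`, `wⱼ ∈ ℝ³`, and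
`p, q ∈ ℝᵐ`. -/
abbrev SpaceP (n m : ℕ) : Type :=
  (Fin n → Fin 3 → ℝ) × (Fin m → ℝ) × (Fin m → ℝ)

/-- The Hopf map `J : ℂ × ℂ → ℝ³`. -/
def hopf (z₁ z₂ : ℂ) : Fin 3 → ℝ :=
  ![(2 * (z₁ * star z₂).re) / 4, (2 * (z₁ * star z₂).im) / 4,
    (Complex.normSq z₁ - Complex.normSq z₂) / 4]

/-- The realization `ψ : N → P`: `n` copies of the Hopf map, and the identity on `T*ℝᵐ`. -/
def realization {n m : ℕ} (x : SpaceN n m) : SpaceP n m :=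
  (fun j => hopf (x.1 j) (x.2.1 j), x.2.2.1, x.2.2.2)

/-- `M = S₂ⁿ × T*ℝᵐ`, as a subset of `P`: all the `wⱼ` are Euclidean unit vectors. -/
def spaceM (n m : ℕ) : Set (SpaceP n m) :=
  {y | ∀ j, y.1 j ⬝ᵥ y.1 j = 1}

/-- The tangent space of `M` at `y ∈ M`, as a set of vectors in `P`. -/
def tangentM {n m : ℕ} (y : SpaceP n m) : Set (SpaceP n m) :=
  {u | ∀ j, y.1 j ⬝ᵥ u.1 j = 0}

/-! ### Symplectic and Poisson structures -/

/-- The canonical symplectic form on `N = ℂ²ⁿ × T*ℝᵐ`, that is `∑ d(position) ∧ d(momentum)`.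
On the complex coordinates, momenta are real parts and positions are imaginary parts
(this is the orientation of `ℂ² = T*ℝ²` for which the Hopf map is Poisson). -/
def omegaN {n m : ℕ} (u v : SpaceN n m) : ℝ :=
  (∑ j, ((u.1 j).im * (v.1 j).re - (u.1 j).re * (v.1 j).im))
    + (∑ j, ((u.2.1 j).im * (v.2.1 j).re - (u.2.1 j).re * (v.2.1 j).im))
    + ∑ i, (u.2.2.2 i * v.2.2.1 i - u.2.2.1 i * v.2.2.2 i)

/-- The Hamiltonian vector field of `K : N → ℝ` for `omegaN`:
`(position)' = ∂K/∂(momentum)`, `(momentum)' = -∂K/∂(position)`. -/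
def hamVectorField {n m : ℕ} (K : SpaceN n m → ℝ) (x : SpaceN n m) : SpaceN n m :=
  (fun j => ⟨-fderiv ℝ K x (Pi.single j Complex.I, 0, 0, 0),
      fderiv ℝ K x (Pi.single j 1, 0, 0, 0)⟩,
   fun j => ⟨-fderiv ℝ K x (0, Pi.single j Complex.I, 0, 0),
      fderiv ℝ K x (0, Pi.single j 1, 0, 0)⟩,
   fun i => -fderiv ℝ K x (0, 0, 0, Pi.single i 1),
   fun i => fderiv ℝ K x (0, 0, Pi.single i 1, 0))

/-- The gradient `∂f/∂wⱼ ∈ ℝ³` of a function on `P`. -/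
def gradW {n m : ℕ} (f : SpaceP n m → ℝ) (y : SpaceP n m) (j : Fin n) : Fin 3 → ℝ :=
  fun k => fderiv ℝ f y (Pi.single j (Pi.single k 1), 0, 0)

/-- `∂f/∂pᵢ` for a function on `P`. -/
def partialP {n m : ℕ} (f : SpaceP n m → ℝ) (y : SpaceP n m) (i : Fin m) : ℝ :=
  fderiv ℝ f y (0, Pi.single i 1, 0)

/-- `∂f/∂qᵢ` for a function on `P`. -/
def partialQ {n m : ℕ} (f : SpaceP n m → ℝ) (y : SpaceP n m) (i : Fin m) : ℝ :=
  fderiv ℝ f y (0, 0, Pi.single i 1)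

/-- The Poisson bracket on `P`: the canonical bracket on `T*ℝᵐ` plus
`∑ⱼ ⟨wⱼ, ∂f/∂wⱼ × ∂g/∂wⱼ⟩`. -/
def poissonBracket {n m : ℕ} (f g : SpaceP n m → ℝ) (y : SpaceP n m) : ℝ :=
  (∑ i, (partialQ f y i * partialP g y i - partialP f y i * partialQ g y i))
    + ∑ j, y.1 j ⬝ᵥ (gradW f y j ⨯₃ gradW g y j)

/-- The symplectic form of `M` at `y`, for tangent vectors `u, v` of `M` at `y`: the canonical
form of `T*ℝᵐ` plus the sum of the area forms `(u, v) ↦ ⟨wⱼ, uⱼ × vⱼ⟩` of the unit spheres. -/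
def omegaM {n m : ℕ} (y u v : SpaceP n m) : ℝ :=
  (∑ i, (u.2.2 i * v.2.1 i - u.2.1 i * v.2.2 i)) + ∑ j, y.1 j ⬝ᵥ (u.1 j ⨯₃ v.1 j)

/-- `Φ` is symplectic on the open set `V ⊆ N`: its differential preserves `omegaN`. -/
def IsSymplecticOnN {n m : ℕ} (Φ : SpaceN n m → SpaceN n m) (V : Set (SpaceN n m)) : Prop :=
  ∀ x ∈ V, DifferentiableAt ℝ Φ x ∧
    ∀ u v, omegaN (fderiv ℝ Φ x u) (fderiv ℝ Φ x v) = omegaN u v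

/-- `φ` is a Poisson map on the open set `W ⊆ P`. -/
def IsPoissonOnP {n m : ℕ} (φ : SpaceP n m → SpaceP n m) (W : Set (SpaceP n m)) : Prop :=
  ∀ y ∈ W, DifferentiableAt ℝ φ y ∧
    ∀ f g : SpaceP n m → ℝ, DifferentiableAt ℝ f (φ y) → DifferentiableAt ℝ g (φ y) →
      poissonBracket (f ∘ φ) (g ∘ φ) y = poissonBracket f g (φ y)

/-- `φ` maps every point of `W` to a point of the same symplectic leaf of `P`; the leaves are
the sets on which every `‖wⱼ‖` is constant. -/
def PreservesLeavesOn {n m : ℕ} (φ : SpaceP n m → SpaceP n m) (W : Set (SpaceP n m)) : Prop :=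
  ∀ y ∈ W, ∀ j, (φ y).1 j ⬝ᵥ (φ y).1 j = y.1 j ⬝ᵥ y.1 j

/-- `φ`, defined on the open set `W ⊆ P`, restricts to a symplectic map from the open subset
`M ∩ W` of `M` to `M`. -/
def RestrictsToSymplecticOnM {n m : ℕ} (φ : SpaceP n m → SpaceP n m)
    (W : Set (SpaceP n m)) : Prop :=
  ∀ y ∈ spaceM n m ∩ W, φ y ∈ spaceM n m ∧ DifferentiableAt ℝ φ y ∧
    (∀ u ∈ tangentM y, fderiv ℝ φ y u ∈ tangentM (φ y)) ∧
    ∀ u ∈ tangentM y, ∀ v ∈ tangentM y,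
      omegaM (φ y) (fderiv ℝ φ y u) (fderiv ℝ φ y v) = omegaM y u v

/-! ### Partitioned Runge–Kutta methods -/

/-- The coefficients of an `s`-stage Runge–Kutta method. -/
structure RKTableau (s : ℕ) where
  a : Fin s → Fin s → ℝ
  b : Fin s → ℝ

/-- The coefficient condition for a symplectic Runge–Kutta method. -/
def RKTableau.IsSymplectic {s : ℕ} (T : RKTableau s) : Prop :=
  ∀ i j, T.b i * T.b j = T.b i * T.a i j + T.b j * T.a j i

/-- The coefficient condition for a symplectic partitioned Runge–Kutta method which integrates
`q` with the tableau `Tq` and `p` with the tableau `Tp`. -/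
def IsSymplecticPair {s : ℕ} (Tp Tq : RKTableau s) : Prop :=
  (∀ i j, Tp.b i * Tq.b j = Tp.b i * Tq.a i j + Tq.b j * Tp.a j i) ∧ ∀ i, Tq.b i = Tp.b i

/-- A partitioned Runge–Kutta method on `N`: one tableau for each of `z = (z₁, z₂)`, `p`, `q`. -/
structure PRKMethod (s : ℕ) where
  tz : RKTableau s
  tp : RKTableau s
  tq : RKTableau s

/-- Multiply the `z`-, `p`- and `q`-component of `v ∈ N` by `α`, `β`, `γ`. -/
def scaleN {n m : ℕ} (α β γ : ℝ) (v : SpaceN n m) : SpaceN n m :=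
  (α • v.1, α • v.2.1, β • v.2.2.1, γ • v.2.2.2)

/-- Right-hand side of the stage equations `Y_i = x + h ∑ⱼ a_ij f(Y_j)`, where the coefficients
depend on the component. -/
def PRKMethod.stageMap {s n m : ℕ} (T : PRKMethod s) (h : ℝ) (f : SpaceN n m → SpaceN n m)
    (x : SpaceN n m) (Y : Fin s → SpaceN n m) : Fin s → SpaceN n m :=
  fun i => x + h • ∑ j, scaleN (T.tz.a i j) (T.tp.a i j) (T.tq.a i j) (f (Y j))

/-- The update `x̃ = x + h ∑ᵢ b_i f(Y_i)`, where the coefficients depend on the component. -/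
def PRKMethod.update {s n m : ℕ} (T : PRKMethod s) (h : ℝ) (f : SpaceN n m → SpaceN n m)
    (x : SpaceN n m) (Y : Fin s → SpaceN n m) : SpaceN n m :=
  x + h • ∑ i, scaleN (T.tz.b i) (T.tp.b i) (T.tq.b i) (f (Y i))

/-- One step of the (in general implicit) method is well defined on `V`, with stage values
`Y x`: for `x ∈ V` the stages `Y x` lie in the domain `Ω` of the vector field `f`, depend
continuously on `x`, solve the stage equations, and are a regular solution: the stage equations,
linearized in the stages, are uniquely solvable. The integrator is then the map
`x ↦ T.update h f x (Y x)` on `V`. -/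
structure PRKMethod.IsIntegrator {s n m : ℕ} (T : PRKMethod s) (h : ℝ)
    (f : SpaceN n m → SpaceN n m) (Ω V : Set (SpaceN n m))
    (Y : SpaceN n m → Fin s → SpaceN n m) : Prop where
  continuousOn : ContinuousOn Y V
  mem_domain : ∀ x ∈ V, ∀ i, Y x i ∈ Ω
  stage_eq : ∀ x ∈ V, Y x = T.stageMap h f x (Y x)
  regular : ∀ x ∈ V, Function.Bijective
    (fderiv ℝ (fun S : Fin s → SpaceN n m => S - T.stageMap h f x S) (Y x))

end CollectiveSymplectic

end

open CollectiveSymplectic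

noncomputable section

namespace CollectiveSymplectic

open Filter Topology

/-! ### Consequences of the inverse function theorem -/

section InverseFunction

variable {E F X : Type*} [NormedAddCommGroup E] [NormedSpace ℝ E] [CompleteSpace E]
  [NormedAddCommGroup F] [NormedSpace ℝ F] [CompleteSpace F]

/-! Symplecticity on `N` is the classical fact about quadratic forms. The conditions on the
coefficients give a discrete product rule for the product of two coordinates (`rk_mul_identity`),
and equality of the `b`-coefficients lets these rules be summed to one for `omegaN`. Applied to the
linearized stages it leaves only terms that vanish because the derivative of a Hamiltonian field is
infinitesimally symplectic.

For the descent, read each pair `(z₁ʲ, z₂ʲ)` as a quaternion. A pulled-back Hamiltonian field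
multiplies it from the left by an imaginary quaternion depending only on `ψ(x)`
(`sharpN_comp_fderiv_realization`). Left multiplication commutes with phases, and the fibres of `ψ`
are the torus orbits. The torus is path connected and regular solutions are locally unique, so the
stages are equivariant (`stages_torusN`) and the update maps fibres to fibres.

The delicate point is smoothness of the descended map where some `(z₁ʲ, z₂ʲ)` vanishes: there `ψ` is
not a submersion and has no smooth local sections. Instead, the stages are written as `Y_i = c_i ·
x` with quaternions `c_i`. These satisfy stage equations whose data involve only `y = ψ(x)`, because
`ψ(c · x)` is a function of `c` and `y` (`realization_actN`). If the reduced equations are regular,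
the implicit function theorem makes `c` a smooth function of `y`, and the image point is a smooth
function of `c` and `y`. Solvability and regularity are inherited from the original equations
(`exists_reduced_stages`); where `x` vanishes, `c` is not determined by `Y`, but on these
undetermined directions the two linearizations coincide.

The geometric properties then follow from those of `ψ`. It is a surjective Poisson map, so a map
covered by a symplectic one is Poisson. The norm of `w_j` is `(|z₁ʲ|² + |z₂ʲ|²)/4`, a quadratic
invariant that the method preserves, so leaves are preserved. On `M`, tangent vectors lift to `N`,
and there the area forms pull back to `omegaN`. -/

theorem isInvertible_of_bijective {L : E →L[ℝ] F} (h : Function.Bijective L) : L.IsInvertible :=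
  ⟨ContinuousLinearEquiv.ofBijective L (LinearMap.ker_eq_bot.2 h.1) (LinearMap.range_eq_top.2 h.2),
    rfl⟩

/-- Local uniqueness: near a regular point `a` of `g`, `g` is injective. -/
theorem eventuallyEq_of_comp_eq {g : E → F} {a : E} (hg : ContDiffAt ℝ 1 g a)
    (hbij : Function.Bijective (fderiv ℝ g a)) {l : Filter X} {y₁ y₂ : X → E}
    (h₁ : Tendsto y₁ l (𝓝 a)) (h₂ : Tendsto y₂ l (𝓝 a)) (h : ∀ᶠ x in l, g (y₁ x) = g (y₂ x)) :
    y₁ =ᶠ[l] y₂ := by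
  obtain ⟨e, he⟩ := isInvertible_of_bijective hbij
  have hs : HasStrictFDerivAt g (e : E →L[ℝ] F) a := by
    rw [he]; exact hg.hasStrictFDerivAt one_ne_zero
  have hinv := hs.eventually_left_inverse
  filter_upwards [h₁.eventually hinv, h₂.eventually hinv, h] with x hx₁ hx₂ hx
  rw [← hx₁, hx, hx₂]

/-- A continuous solution `y` of `g (y x) = k x` through a regular point is as smooth as the
data. -/
theorem contDiffAt_of_comp_contDiffAt [NormedAddCommGroup X] [NormedSpace ℝ X]
    {g : E → F} {y : X → E} {x₀ : X} {r : WithTop ℕ∞}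
    (hr : r ≠ 0) (hg : ContDiffAt ℝ r g (y x₀)) (hbij : Function.Bijective (fderiv ℝ g (y x₀)))
    (hy : ContinuousAt y x₀) (hgy : ContDiffAt ℝ r (fun x => g (y x)) x₀) :
    ContDiffAt ℝ r y x₀ := by
  obtain ⟨e, he⟩ := isInvertible_of_bijective hbij
  have hd : HasFDerivAt g (e : E →L[ℝ] F) (y x₀) := by
    rw [he]; exact (hg.differentiableAt hr).hasFDerivAt
  have hinv := (hg.hasStrictFDerivAt' hd hr).eventually_left_inverse
  refine ((hg.to_localInverse hd hr).comp x₀ hgy).congr_of_eventuallyEq ?_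
  -- Continuity keeps `y` in the neighbourhood where the local inverse applies, so `y` is the local
  -- inverse composed with `g ∘ y`.
  filter_upwards [hy.eventually hinv] with x hx
  exact hx.symm

end InverseFunction

/-! ### The stage equations -/

variable {n m s : ℕ}

theorem scaleN_add (α β γ : ℝ) (u v : SpaceN n m) :
    scaleN α β γ (u + v) = scaleN α β γ u + scaleN α β γ v := by
  simp [scaleN, smul_add]

theorem scaleN_smul (α β γ c : ℝ) (u : SpaceN n m) :
    scaleN α β γ (c • u) = c • scaleN α β γ u := by
  simp [scaleN, smul_comm c]

/-- The linear map which combines the values of the vector field at the stages into the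
increments of the stages. -/
def PRKMethod.stageLin (T : PRKMethod s) :
    (Fin s → SpaceN n m) →L[ℝ] (Fin s → SpaceN n m) :=
  LinearMap.toContinuousLinearMap
    { toFun := fun F i => ∑ j, scaleN (T.tz.a i j) (T.tp.a i j) (T.tq.a i j) (F j)
      map_add' := fun F G => by
        ext1 i
        simp [scaleN_add, Finset.sum_add_distrib]
      map_smul' := fun c F => by
        ext1 i
        simp only [Pi.smul_apply, scaleN_smul, Finset.smul_sum, RingHom.id_apply] }

/-- The linear map which combines the values of the vector field at the stages into the
increment of the update. -/
def PRKMethod.updateLin (T : PRKMethod s) : (Fin s → SpaceN n m) →L[ℝ] SpaceN n m :=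
  LinearMap.toContinuousLinearMap
    { toFun := fun F => ∑ i, scaleN (T.tz.b i) (T.tp.b i) (T.tq.b i) (F i)
      map_add' := fun F G => by
        simp [scaleN_add, Finset.sum_add_distrib]
      map_smul' := fun c F => by
        simp only [Pi.smul_apply, scaleN_smul, Finset.smul_sum, RingHom.id_apply] }

theorem PRKMethod.stageLin_apply (T : PRKMethod s) (F : Fin s → SpaceN n m) (i : Fin s) :
    T.stageLin F i = ∑ j, scaleN (T.tz.a i j) (T.tp.a i j) (T.tq.a i j) (F j) := rfl

theorem PRKMethod.updateLin_apply (T : PRKMethod s) (F : Fin s → SpaceN n m) :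
    T.updateLin F = ∑ i, scaleN (T.tz.b i) (T.tp.b i) (T.tq.b i) (F i) := rfl

/-- The part of the stage equations which does not contain the initial value: the stages `S` of
the point `x` solve `T.residual h f S = fun _ => x`. -/
def PRKMethod.residual (T : PRKMethod s) (h : ℝ) (f : SpaceN n m → SpaceN n m)
    (S : Fin s → SpaceN n m) : Fin s → SpaceN n m :=
  S - h • T.stageLin (fun j => f (S j))

theorem PRKMethod.stageMap_eq (T : PRKMethod s) (h : ℝ) (f : SpaceN n m → SpaceN n m)
    (x : SpaceN n m) (S : Fin s → SpaceN n m) :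
    T.stageMap h f x S = (fun _ => x) + h • T.stageLin (fun j => f (S j)) := rfl

theorem PRKMethod.update_eq (T : PRKMethod s) (h : ℝ) (f : SpaceN n m → SpaceN n m)
    (x : SpaceN n m) (S : Fin s → SpaceN n m) :
    T.update h f x S = x + h • T.updateLin (fun j => f (S j)) := rfl

theorem PRKMethod.eq_stageMap_iff (T : PRKMethod s) (h : ℝ) (f : SpaceN n m → SpaceN n m)
    (x : SpaceN n m) (S : Fin s → SpaceN n m) :
    S = T.stageMap h f x S ↔ T.residual h f S = fun _ => x := by
  rw [T.stageMap_eq, PRKMethod.residual, sub_eq_iff_eq_add]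

/-- The initial value enters the stage equations only as an additive constant, so regularity is a
property of `residual` at the stages. -/
theorem PRKMethod.fderiv_sub_stageMap (T : PRKMethod s) (h : ℝ) (f : SpaceN n m → SpaceN n m)
    (x : SpaceN n m) (Y : Fin s → SpaceN n m) :
    fderiv ℝ (fun S : Fin s → SpaceN n m => S - T.stageMap h f x S) Y =
      fderiv ℝ (T.residual h f) Y := by
  have : (fun S : Fin s → SpaceN n m => S - T.stageMap h f x S) =
      fun S => T.residual h f S - (fun _ => x) := by
    funext S
    rw [T.stageMap_eq, PRKMethod.residual]
    abel
  rw [this, fderiv_sub_const]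

theorem PRKMethod.contDiffAt_residual (T : PRKMethod s) (h : ℝ) {f : SpaceN n m → SpaceN n m}
    {Y : Fin s → SpaceN n m} {r : WithTop ℕ∞} (hf : ∀ i, ContDiffAt ℝ r f (Y i)) :
    ContDiffAt ℝ r (T.residual h f) Y := by
  have h1 : ContDiffAt ℝ r (fun S : Fin s → SpaceN n m => fun j => f (S j)) Y :=
    contDiffAt_pi.2 fun j => (hf j).comp Y (contDiff_apply ℝ (SpaceN n m) j).contDiffAt
  exact contDiffAt_id.sub ((T.stageLin.contDiff.contDiffAt.comp Y h1).const_smul h)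

theorem PRKMethod.fderiv_residual (T : PRKMethod s) (h : ℝ) {f : SpaceN n m → SpaceN n m}
    {Y : Fin s → SpaceN n m} (hf : ∀ i, DifferentiableAt ℝ f (Y i)) (δ : Fin s → SpaceN n m) :
    fderiv ℝ (T.residual h f) Y δ = δ - h • T.stageLin (fun j => fderiv ℝ f (Y j) (δ j)) := by
  have h1 : HasFDerivAt (fun S : Fin s → SpaceN n m => fun j => f (S j))
      (ContinuousLinearMap.pi fun j =>
        (fderiv ℝ f (Y j)).comp (ContinuousLinearMap.proj (R := ℝ) (φ := fun _ => SpaceN n m) j))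
      Y :=
    hasFDerivAt_pi.2 fun j =>
      (hf j).hasFDerivAt.comp Y
        (ContinuousLinearMap.proj (R := ℝ) (φ := fun _ => SpaceN n m) j).hasFDerivAt
  have h2 : HasFDerivAt (T.residual h f) _ Y :=
    (hasFDerivAt_id Y).sub ((T.stageLin.hasFDerivAt.comp Y h1).const_smul h)
  rw [h2.fderiv]
  rfl

namespace PRKMethod.IsIntegrator

variable {T : PRKMethod s} {h : ℝ} {f : SpaceN n m → SpaceN n m} {Ω V : Set (SpaceN n m)}
  {Y : SpaceN n m → Fin s → SpaceN n m}

theorem residual_eq (hI : T.IsIntegrator h f Ω V Y) {x : SpaceN n m} (hx : x ∈ V) :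
    T.residual h f (Y x) = fun _ => x :=
  (T.eq_stageMap_iff h f x (Y x)).1 (hI.stage_eq x hx)

theorem bijective_fderiv_residual (hI : T.IsIntegrator h f Ω V Y) {x : SpaceN n m} (hx : x ∈ V) :
    Function.Bijective (fderiv ℝ (T.residual h f) (Y x)) := by
  rw [← T.fderiv_sub_stageMap h f x]
  exact hI.regular x hx

/-- Since `residual ∘ Y` is the diagonal embedding of `x`, which is smooth, regularity upgrades
continuity of the stages to smoothness. -/
theorem contDiffAt_stages (hI : T.IsIntegrator h f Ω V Y) (hΩ : IsOpen Ω) (hV : IsOpen V)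
    {r : WithTop ℕ∞} (hr : r ≠ 0) (hf : ContDiffOn ℝ r f Ω) {x : SpaceN n m} (hx : x ∈ V) :
    ContDiffAt ℝ r Y x := by
  refine contDiffAt_of_comp_contDiffAt hr
    (T.contDiffAt_residual h fun i => hf.contDiffAt (hΩ.mem_nhds (hI.mem_domain x hx i)))
    (hI.bijective_fderiv_residual hx) (hI.continuousOn.continuousAt (hV.mem_nhds hx)) ?_
  refine ContDiffAt.congr_of_eventuallyEq
    (contDiffAt_pi.2 fun _ => contDiffAt_id :
      ContDiffAt ℝ r (fun (x : SpaceN n m) (_ : Fin s) => x) x) ?_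
  filter_upwards [hV.mem_nhds hx] with x' hx'
  exact hI.residual_eq hx'

theorem contDiffAt_update (hI : T.IsIntegrator h f Ω V Y) (hΩ : IsOpen Ω) (hV : IsOpen V)
    {r : WithTop ℕ∞} (hr : r ≠ 0) (hf : ContDiffOn ℝ r f Ω) {x : SpaceN n m} (hx : x ∈ V) :
    ContDiffAt ℝ r (fun x => T.update h f x (Y x)) x := by
  have hY := hI.contDiffAt_stages hΩ hV hr hf hx
  have h1 : ContDiffAt ℝ r (fun x => fun j => f (Y x j)) x :=
    contDiffAt_pi.2 fun j =>
      (hf.contDiffAt (hΩ.mem_nhds (hI.mem_domain x hx j))).comp x (contDiffAt_pi.1 hY j)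
  exact contDiffAt_id.add ((T.updateLin.contDiff.contDiffAt.comp x h1).const_smul h)

/-- The linearized stage equations and the linearized update. -/
theorem fderiv_stages_update (hI : T.IsIntegrator h f Ω V Y) (hΩ : IsOpen Ω) (hV : IsOpen V)
    (hf : ContDiffOn ℝ 1 f Ω) {x : SpaceN n m} (hx : x ∈ V) (u : SpaceN n m) :
    ∃ ξ : Fin s → SpaceN n m,
      (∀ i, ξ i = u + h • T.stageLin (fun j => fderiv ℝ f (Y x j) (ξ j)) i) ∧
      fderiv ℝ (fun x => T.update h f x (Y x)) x u =
        u + h • T.updateLin (fun j => fderiv ℝ f (Y x j) (ξ j)) := by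
  have hY := (hI.contDiffAt_stages hΩ hV one_ne_zero hf hx).differentiableAt one_ne_zero
  have hfd : ∀ j, DifferentiableAt ℝ f (Y x j) := fun j =>
    (hf.contDiffAt (hΩ.mem_nhds (hI.mem_domain x hx j))).differentiableAt one_ne_zero
  have h1 : HasFDerivAt (fun x => fun j => f (Y x j))
      (ContinuousLinearMap.pi fun j => (fderiv ℝ f (Y x j)).comp
        ((ContinuousLinearMap.proj (R := ℝ) (φ := fun _ => SpaceN n m) j).comp
          (fderiv ℝ Y x))) x :=
    hasFDerivAt_pi.2 fun j =>
      (hfd j).hasFDerivAt.comp x (hasFDerivAt_pi'.1 hY.hasFDerivAt j)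
  refine ⟨fderiv ℝ Y x u, fun i => ?_, ?_⟩
  -- The derivative of `residual ∘ Y` is computed twice, by the chain rule and from the stage
  -- equations; uniqueness gives the linearized equations.
  · have h2 : HasFDerivAt (fun x => T.residual h f (Y x)) _ x :=
      hY.hasFDerivAt.sub ((T.stageLin.hasFDerivAt.comp x h1).const_smul h)
    have h3 : HasFDerivAt (fun x => T.residual h f (Y x))
        (ContinuousLinearMap.pi fun _ => ContinuousLinearMap.id ℝ (SpaceN n m)) x := by
      refine HasFDerivAt.congr_of_eventuallyEq
        (hasFDerivAt_pi.2 fun _ => hasFDerivAt_id x :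
          HasFDerivAt (fun (x : SpaceN n m) (_ : Fin s) => x) _ x) ?_
      filter_upwards [hV.mem_nhds hx] with x' hx'
      exact hI.residual_eq hx'
    have h4 := congrFun (congrArg (fun L => L u) (h2.unique h3)) i
    exact sub_eq_iff_eq_add.1 h4
  · have h2 : HasFDerivAt (fun x => T.update h f x (Y x)) _ x :=
      (hasFDerivAt_id x).add ((T.updateLin.hasFDerivAt.comp x h1).const_smul h)
    rw [h2.fderiv]
    rfl

end PRKMethod.IsIntegrator

/-! ### Hamiltonian vector fields -/

/-- The Hamiltonian vector field as a linear function of the differential: the map from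
covectors to vectors given by `omegaN`. -/
def sharpN : (SpaceN n m →L[ℝ] ℝ) →L[ℝ] SpaceN n m :=
  LinearMap.toContinuousLinearMap
    { toFun := fun α =>
        (fun j => ⟨-α (Pi.single j Complex.I, 0, 0, 0), α (Pi.single j 1, 0, 0, 0)⟩,
         fun j => ⟨-α (0, Pi.single j Complex.I, 0, 0), α (0, Pi.single j 1, 0, 0)⟩,
         fun i => -α (0, 0, 0, Pi.single i 1),
         fun i => α (0, 0, Pi.single i 1, 0))
      map_add' := fun α β => by
        ext <;> first
          | (apply Complex.ext <;> simp <;> ring)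
          | (simp <;> ring)
      map_smul' := fun c α => by
        ext <;> first
          | (apply Complex.ext <;> simp)
          | simp }

theorem hamVectorField_eq (K : SpaceN n m → ℝ) (x : SpaceN n m) :
    hamVectorField K x = sharpN (fderiv ℝ K x) := rfl

theorem covector_apply (α : SpaceN n m →L[ℝ] ℝ) (v : SpaceN n m) :
    α v = (∑ j, ((v.1 j).re * α (Pi.single j 1, 0, 0, 0)
          + (v.1 j).im * α (Pi.single j Complex.I, 0, 0, 0)))
      + (∑ j, ((v.2.1 j).re * α (0, Pi.single j 1, 0, 0)
          + (v.2.1 j).im * α (0, Pi.single j Complex.I, 0, 0)))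
      + ∑ i, (v.2.2.2 i * α (0, 0, 0, Pi.single i 1) + v.2.2.1 i * α (0, 0, Pi.single i 1, 0)) := by
  have hv : v = (∑ j, ((v.1 j).re • ((Pi.single j 1, 0, 0, 0) : SpaceN n m)
          + (v.1 j).im • ((Pi.single j Complex.I, 0, 0, 0) : SpaceN n m)))
      + (∑ j, ((v.2.1 j).re • ((0, Pi.single j 1, 0, 0) : SpaceN n m)
          + (v.2.1 j).im • ((0, Pi.single j Complex.I, 0, 0) : SpaceN n m)))
      + ∑ i, (v.2.2.2 i • ((0, 0, 0, Pi.single i 1) : SpaceN n m)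
          + v.2.2.1 i • ((0, 0, Pi.single i 1, 0) : SpaceN n m)) := by
    ext k <;> simp [Prod.fst_sum, Prod.snd_sum, Finset.sum_apply, Pi.single_apply,
      Finset.sum_add_distrib, apply_ite]
  conv_lhs => rw [hv]
  simp only [map_add, map_sum, map_smul, smul_eq_mul]

/-- This is the relation `ω_N(X_K, ·) = dK`: it ties the coordinate formula for the Hamiltonian
field to the symplectic form and fixes all signs. -/
theorem omegaN_sharpN (α : SpaceN n m →L[ℝ] ℝ) (v : SpaceN n m) :
    omegaN (sharpN α) v = α v := by
  rw [covector_apply α v, omegaN]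
  congr 1
  · congr 1 <;> refine Finset.sum_congr rfl fun j _ => ?_ <;> simp [sharpN] <;> ring
  · refine Finset.sum_congr rfl fun j _ => ?_
    simp [sharpN]; ring

theorem omegaN_swap (u v : SpaceN n m) : omegaN u v = -omegaN v u := by
  simp only [omegaN, neg_add, ← Finset.sum_neg_distrib]
  congr 1
  · congr 1 <;> exact Finset.sum_congr rfl fun j _ => by ring
  · exact Finset.sum_congr rfl fun j _ => by ring

/-- Nondegeneracy: each coordinate is recovered by pairing with the basis vector of its conjugate
coordinate. -/
theorem omegaN_right_ext {u u' : SpaceN n m} (h : ∀ v, omegaN u v = omegaN u' v) : u = u' := by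
  refine Prod.ext (funext fun j => ?_)
    (Prod.ext (funext fun j => ?_) (Prod.ext (funext fun i => ?_) (funext fun i => ?_)))
  · refine Complex.ext ?_ ?_
    · simpa [omegaN, Pi.single_apply, apply_ite] using h (Pi.single j Complex.I, 0, 0, 0)
    · simpa [omegaN, Pi.single_apply, apply_ite] using h (Pi.single j 1, 0, 0, 0)
  · refine Complex.ext ?_ ?_
    · simpa [omegaN, Pi.single_apply, apply_ite] using h (0, Pi.single j Complex.I, 0, 0)
    · simpa [omegaN, Pi.single_apply, apply_ite] using h (0, Pi.single j 1, 0, 0)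
  · simpa [omegaN, Pi.single_apply] using h (0, 0, 0, Pi.single i 1)
  · simpa [omegaN, Pi.single_apply] using h (0, 0, Pi.single i 1, 0)

theorem contDiffOn_hamVectorField {K : SpaceN n m → ℝ} {Ω : Set (SpaceN n m)} {r : WithTop ℕ∞}
    (hΩ : IsOpen Ω) (hK : ContDiffOn ℝ (r + 1) K Ω) : ContDiffOn ℝ r (hamVectorField K) Ω :=
  (sharpN.contDiff (n := r)).comp_contDiffOn (hK.fderiv_of_isOpen hΩ le_rfl)

/-- The differential of a Hamiltonian vector field is infinitesimally symplectic. -/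
theorem omegaN_fderiv_hamVectorField {K : SpaceN n m → ℝ} {x : SpaceN n m}
    (hK : ContDiffAt ℝ 2 K x) (ξ η : SpaceN n m) :
    omegaN (fderiv ℝ (hamVectorField K) x ξ) η + omegaN ξ (fderiv ℝ (hamVectorField K) x η) = 0 := by
  have hd : DifferentiableAt ℝ (fderiv ℝ K) x :=
    (hK.fderiv_right (m := 1) (by norm_num)).differentiableAt one_ne_zero
  have h1 : HasFDerivAt (hamVectorField K) (sharpN.comp (fderiv ℝ (fderiv ℝ K) x)) x :=
    sharpN.hasFDerivAt.comp x hd.hasFDerivAt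
  -- With `ω_N(DX_K ξ, η) = D²K(ξ, η)`, the symmetry of the second derivative cancels against the
  -- antisymmetry of `ω_N`.
  have hsymm : IsSymmSndFDerivAt ℝ K x := hK.isSymmSndFDerivAt (by simp)
  rw [h1.fderiv, omegaN_swap ξ]
  simp only [ContinuousLinearMap.comp_apply, omegaN_sharpN]
  rw [hsymm.eq ξ η, add_neg_cancel]

/-! ### Quadratic forms and partitioned Runge–Kutta methods -/

/-- Expanding the left side leaves the second-order term `h² (∑ bᵢFᵢ)(∑ b'ⱼGⱼ)`. The coefficient
condition splits each `bᵢb'ⱼ` into exactly the two terms by which the stages `ξ` and `η` differ from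
the initial values `u` and `v`. -/
theorem rk_mul_identity {a a' : Fin s → Fin s → ℝ} {b b' : Fin s → ℝ}
    (hab : ∀ i j, b i * b' j = b i * a' i j + b' j * a j i) (hb : ∀ i, b i = b' i)
    {h u v : ℝ} {F G ξ η : Fin s → ℝ}
    (hξ : ∀ i, ξ i = u + h * ∑ j, a i j * F j) (hη : ∀ i, η i = v + h * ∑ j, a' i j * G j) :
    (u + h * ∑ i, b i * F i) * (v + h * ∑ i, b' i * G i) =
      u * v + h * ∑ i, b i * (F i * η i + ξ i * G i) := by
  have h1 : (∑ i, b i * F i) * ∑ j, b' j * G j =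
      ∑ i, b i * F i * ∑ j, a' i j * G j + ∑ i, b i * G i * ∑ j, a i j * F j := by
    rw [Finset.sum_mul_sum]
    simp only [Finset.mul_sum]
    rw [Finset.sum_comm (f := fun i j => b i * G i * (a i j * F j)), ← Finset.sum_add_distrib]
    refine Finset.sum_congr rfl fun i _ => ?_
    rw [← Finset.sum_add_distrib]
    refine Finset.sum_congr rfl fun j _ => ?_
    linear_combination F i * G j * hab i j - a j i * F i * G j * hb j
  have h2 : ∑ i, b' i * G i = ∑ i, b i * G i := by simp only [hb]
  have h3 : ∑ i, b i * (F i * η i + ξ i * G i) =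
      (∑ i, b i * F i) * v + u * (∑ i, b i * G i)
        + h * (∑ i, b i * F i * ∑ j, a' i j * G j + ∑ i, b i * G i * ∑ j, a i j * F j) := by
    rw [Finset.sum_mul, Finset.mul_sum, ← Finset.sum_add_distrib, ← Finset.sum_add_distrib,
      Finset.mul_sum, ← Finset.sum_add_distrib]
    refine Finset.sum_congr rfl fun i _ => ?_
    rw [hξ, hη]
    ring
  rw [h3, ← h1, h2]
  ring

/-- `B` satisfies the discrete Leibniz rule for the method `T`. -/
def PRKMethod.Leibniz (T : PRKMethod s) (B : SpaceN n m → SpaceN n m → ℝ) : Prop :=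
  ∀ (h : ℝ) (u v : SpaceN n m) (F G ξ η : Fin s → SpaceN n m),
    (∀ i, ξ i = u + h • T.stageLin F i) → (∀ i, η i = v + h • T.stageLin G i) →
    B (u + h • T.updateLin F) (v + h • T.updateLin G) =
      B u v + h * ∑ i, T.tq.b i * (B (F i) (η i) + B (ξ i) (G i))

namespace PRKMethod

variable {T : PRKMethod s} {B B' : SpaceN n m → SpaceN n m → ℝ}

theorem Leibniz.add (hB : T.Leibniz B) (hB' : T.Leibniz B') :
    T.Leibniz fun u v => B u v + B' u v := by
  intro h u v F G ξ η hξ hη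
  beta_reduce
  rw [hB h u v F G ξ η hξ hη, hB' h u v F G ξ η hξ hη, add_add_add_comm, ← mul_add,
    ← Finset.sum_add_distrib]
  congr 2
  exact Finset.sum_congr rfl fun i _ => by ring

theorem Leibniz.sub (hB : T.Leibniz B) (hB' : T.Leibniz B') :
    T.Leibniz fun u v => B u v - B' u v := by
  intro h u v F G ξ η hξ hη
  beta_reduce
  rw [hB h u v F G ξ η hξ hη, hB' h u v F G ξ η hξ hη, add_sub_add_comm, ← mul_sub,
    ← Finset.sum_sub_distrib]
  congr 2
  exact Finset.sum_congr rfl fun i _ => by ring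

theorem Leibniz.sum {ι : Type*} [Fintype ι] {B : ι → SpaceN n m → SpaceN n m → ℝ}
    (hB : ∀ k, T.Leibniz (B k)) : T.Leibniz fun u v => ∑ k, B k u v := by
  intro h u v F G ξ η hξ hη
  simp only [fun k => hB k h u v F G ξ η hξ hη, Finset.sum_add_distrib, ← Finset.mul_sum]
  rw [Finset.sum_comm]
  congr 2
  refine Finset.sum_congr rfl fun i _ => ?_
  rw [← Finset.mul_sum, Finset.sum_add_distrib]

/-- The product of two coordinates satisfies the Leibniz rule if their coefficients are those of a
symplectic pair. -/
theorem Leibniz.mul_coord (ℓ ℓ' : SpaceN n m →ₗ[ℝ] ℝ) (t t' : RKTableau s)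
    (ha : ∀ i j v, ℓ (scaleN (T.tz.a i j) (T.tp.a i j) (T.tq.a i j) v) = t.a i j * ℓ v)
    (hb : ∀ i v, ℓ (scaleN (T.tz.b i) (T.tp.b i) (T.tq.b i) v) = t.b i * ℓ v)
    (ha' : ∀ i j v, ℓ' (scaleN (T.tz.a i j) (T.tp.a i j) (T.tq.a i j) v) = t'.a i j * ℓ' v)
    (hb' : ∀ i v, ℓ' (scaleN (T.tz.b i) (T.tp.b i) (T.tq.b i) v) = t'.b i * ℓ' v)
    (hab : ∀ i j, t.b i * t'.b j = t.b i * t'.a i j + t'.b j * t.a j i)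
    (hbb : ∀ i, t.b i = t'.b i) (hbq : ∀ i, t.b i = T.tq.b i) :
    T.Leibniz fun u v => ℓ u * ℓ' v := by
  intro h u v F G ξ η hξ hη
  have h1 : ∀ i, ℓ (ξ i) = ℓ u + h * ∑ j, t.a i j * ℓ (F j) := fun i => by
    rw [hξ i, map_add, map_smul, T.stageLin_apply, map_sum, smul_eq_mul]
    simp only [ha]
  have h2 : ∀ i, ℓ' (η i) = ℓ' v + h * ∑ j, t'.a i j * ℓ' (G j) := fun i => by
    rw [hη i, map_add, map_smul, T.stageLin_apply, map_sum, smul_eq_mul]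
    simp only [ha']
  have h3 := rk_mul_identity hab hbb h1 h2
  simp only [map_add, map_smul, T.updateLin_apply, map_sum, smul_eq_mul, hb, hb']
  rw [h3]
  simp only [hbq]

/-- The real-linear map `v ↦ g (v.1 j)`, for a real-linear `g`. -/
def coordZ₁ (g : ℂ →ₗ[ℝ] ℝ) (j : Fin n) : SpaceN n m →ₗ[ℝ] ℝ :=
  g ∘ₗ LinearMap.proj j ∘ₗ LinearMap.fst ℝ _ _

/-- The real-linear map `v ↦ g (v.2.1 j)`, for a real-linear `g`. -/
def coordZ₂ (g : ℂ →ₗ[ℝ] ℝ) (j : Fin n) : SpaceN n m →ₗ[ℝ] ℝ :=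
  g ∘ₗ LinearMap.proj j ∘ₗ LinearMap.fst ℝ _ _ ∘ₗ LinearMap.snd ℝ _ _

/-- The coordinate `pᵢ`. -/
def coordP (i : Fin m) : SpaceN n m →ₗ[ℝ] ℝ :=
  LinearMap.proj i ∘ₗ LinearMap.fst ℝ _ _ ∘ₗ LinearMap.snd ℝ _ _ ∘ₗ LinearMap.snd ℝ _ _

/-- The coordinate `qᵢ`. -/
def coordQ (i : Fin m) : SpaceN n m →ₗ[ℝ] ℝ :=
  LinearMap.proj i ∘ₗ LinearMap.snd ℝ _ _ ∘ₗ LinearMap.snd ℝ _ _ ∘ₗ LinearMap.snd ℝ _ _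

theorem Leibniz.mul_coordZ₁ (hz : T.tz.IsSymplectic) (hb : ∀ i, T.tz.b i = T.tq.b i)
    (g g' : ℂ →ₗ[ℝ] ℝ) (j : Fin n) :
    T.Leibniz fun u v : SpaceN n m => g (u.1 j) * g' (v.1 j) :=
  Leibniz.mul_coord (coordZ₁ g j) (coordZ₁ g' j) T.tz T.tz
    (fun _ _ _ => g.map_smul _ _) (fun _ _ => g.map_smul _ _)
    (fun _ _ _ => g'.map_smul _ _) (fun _ _ => g'.map_smul _ _) hz (fun _ => rfl) hb

theorem Leibniz.mul_coordZ₂ (hz : T.tz.IsSymplectic) (hb : ∀ i, T.tz.b i = T.tq.b i)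
    (g g' : ℂ →ₗ[ℝ] ℝ) (j : Fin n) :
    T.Leibniz fun u v : SpaceN n m => g (u.2.1 j) * g' (v.2.1 j) :=
  Leibniz.mul_coord (coordZ₂ g j) (coordZ₂ g' j) T.tz T.tz
    (fun _ _ _ => g.map_smul _ _) (fun _ _ => g.map_smul _ _)
    (fun _ _ _ => g'.map_smul _ _) (fun _ _ => g'.map_smul _ _) hz (fun _ => rfl) hb

/-- Every term of `omegaN` is a product of two coordinates whose tableaux form a symplectic pair:
`tz` with itself, or `tq` with `tp`. The common weights allow the terms to be added. -/
theorem leibniz_omegaN (hz : T.tz.IsSymplectic) (hpq : IsSymplecticPair T.tp T.tq)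
    (hb : ∀ i, T.tz.b i = T.tq.b i) : T.Leibniz (omegaN (n := n) (m := m)) := by
  refine Leibniz.add (Leibniz.add (Leibniz.sum fun j => ?_) (Leibniz.sum fun j => ?_))
    (Leibniz.sum fun i => ?_)
  · exact Leibniz.sub (Leibniz.mul_coordZ₁ hz hb Complex.imLm Complex.reLm j)
      (Leibniz.mul_coordZ₁ hz hb Complex.reLm Complex.imLm j)
  · exact Leibniz.sub (Leibniz.mul_coordZ₂ hz hb Complex.imLm Complex.reLm j)
      (Leibniz.mul_coordZ₂ hz hb Complex.reLm Complex.imLm j)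
  · refine Leibniz.sub
      (Leibniz.mul_coord (coordQ i) (coordP i) T.tq T.tp (fun _ _ _ => rfl) (fun _ _ => rfl)
        (fun _ _ _ => rfl) (fun _ _ => rfl) (fun i j => ?_) hpq.2 fun _ => rfl)
      (Leibniz.mul_coord (coordP i) (coordQ i) T.tp T.tq (fun _ _ _ => rfl) (fun _ _ => rfl)
        (fun _ _ _ => rfl) (fun _ _ => rfl) hpq.1 (fun i => (hpq.2 i).symm)
        fun i => (hpq.2 i).symm)
    -- The pair condition is not symmetric in form; for the order `q, p` it is read with the indices
    -- exchanged.
    linear_combination hpq.1 j i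

/-- A symplectic partitioned Runge–Kutta method, applied to a Hamiltonian system, is
symplectic. -/
theorem IsIntegrator.isSymplecticOnN {K : SpaceN n m → ℝ} {h : ℝ} {Ω V : Set (SpaceN n m)}
    {Y : SpaceN n m → Fin s → SpaceN n m} (hz : T.tz.IsSymplectic)
    (hpq : IsSymplecticPair T.tp T.tq) (hb : ∀ i, T.tz.b i = T.tq.b i)
    (hΩ : IsOpen Ω) (hK : ContDiffOn ℝ 2 K Ω) (hV : IsOpen V)
    (hI : T.IsIntegrator h (hamVectorField K) Ω V Y) :
    IsSymplecticOnN (fun x => T.update h (hamVectorField K) x (Y x)) V := by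
  have hf : ContDiffOn ℝ 1 (hamVectorField K) Ω :=
    contDiffOn_hamVectorField hΩ (hK.of_le (by norm_num))
  intro x hx
  refine ⟨(hI.contDiffAt_update hΩ hV one_ne_zero hf hx).differentiableAt one_ne_zero, ?_⟩
  intro u v
  obtain ⟨ξ, hξ, hu⟩ := hI.fderiv_stages_update hΩ hV hf hx u
  obtain ⟨η, hη, hv⟩ := hI.fderiv_stages_update hΩ hV hf hx v
  -- The product rule reduces the defect to a sum over the stages, each term of which vanishes for a
  -- Hamiltonian field.
  rw [hu, hv, leibniz_omegaN hz hpq hb h u v _ _ ξ η hξ hη, Finset.sum_eq_zero, mul_zero,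
    add_zero]
  intro i _
  rw [omegaN_fderiv_hamVectorField (hK.contDiffAt (hΩ.mem_nhds (hI.mem_domain x hx i))), mul_zero]

end PRKMethod

/-! ### The Hopf map and its fibres -/

theorem hopf_zero (z₁ z₂ : ℂ) : hopf z₁ z₂ 0 = (z₁.re * z₂.re + z₁.im * z₂.im) / 2 := by
  simp [hopf]; ring

theorem hopf_one (z₁ z₂ : ℂ) : hopf z₁ z₂ 1 = (z₁.im * z₂.re - z₁.re * z₂.im) / 2 := by
  simp [hopf]; ring

theorem hopf_two (z₁ z₂ : ℂ) :
    hopf z₁ z₂ 2 = (z₁.re * z₁.re + z₁.im * z₁.im - (z₂.re * z₂.re + z₂.im * z₂.im)) / 4 := by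
  simp [hopf, Complex.normSq_apply]

/-- Spheres in `ℂ²` go to spheres in `ℝ³`. This controls the fibres, gives properness of `ψ`, and
turns preservation of leaves into preservation of a quadratic form. -/
theorem hopf_dotProduct_self (z₁ z₂ : ℂ) :
    hopf z₁ z₂ ⬝ᵥ hopf z₁ z₂ = ((Complex.normSq z₁ + Complex.normSq z₂) / 4) ^ 2 := by
  simp only [dotProduct, Fin.sum_univ_three, hopf_zero, hopf_one, hopf_two, Complex.normSq_apply]
  ring

/-- With `R = ‖w‖`, a preimage must satisfy `|z₁|² = 2(R + w₂)` and `|z₂|² = 2(R - w₂)`. Take `z₁`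
real; then `z₂` is determined by `w₀` and `w₁` unless `R + w₂ = 0`, in which case `z₁ = 0`. -/
theorem exists_hopf_eq (w : Fin 3 → ℝ) : ∃ z₁ z₂ : ℂ, hopf z₁ z₂ = w := by
  set R := Real.sqrt (w 0 ^ 2 + w 1 ^ 2 + w 2 ^ 2) with hR
  have hR2 : R ^ 2 = w 0 ^ 2 + w 1 ^ 2 + w 2 ^ 2 := Real.sq_sqrt (by positivity)
  have hRw : |w 2| ≤ R := Real.abs_le_sqrt (by nlinarith [sq_nonneg (w 0), sq_nonneg (w 1)])
  rcases (show 0 ≤ R + w 2 by linarith [neg_abs_le (w 2)]).eq_or_lt with h0 | h0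
  · have h01 : w 0 ^ 2 + w 1 ^ 2 = 0 := by
      have : w 2 = -R := by linarith
      rw [this] at hR2; linarith
    have hw0 : w 0 = 0 := by nlinarith [sq_nonneg (w 0), sq_nonneg (w 1)]
    have hw1 : w 1 = 0 := by nlinarith [sq_nonneg (w 0), sq_nonneg (w 1)]
    have hs := Real.mul_self_sqrt (show 0 ≤ 2 * (R - w 2) by linarith [le_abs_self (w 2)])
    refine ⟨0, (Real.sqrt (2 * (R - w 2)) : ℝ), funext fun k => ?_⟩
    fin_cases k
    · simpa [hopf] using hw0.symm
    · simpa [hopf] using hw1.symm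
    · change hopf _ _ 2 = w 2
      rw [hopf_two]
      simp only [Complex.zero_re, Complex.zero_im, Complex.ofReal_re, Complex.ofReal_im]
      linarith
  · set t := Real.sqrt (2 * (R + w 2)) with ht
    have ht0 : 0 < t := Real.sqrt_pos.2 (by linarith)
    have htt : t * t = 2 * (R + w 2) := Real.mul_self_sqrt (by linarith)
    refine ⟨(t : ℝ), ⟨2 * w 0 / t, -(2 * w 1 / t)⟩, funext fun k => ?_⟩
    fin_cases k
    · change hopf _ _ 0 = w 0
      rw [hopf_zero]
      simp only [Complex.ofReal_re, Complex.ofReal_im]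
      field_simp
      ring
    · change hopf _ _ 1 = w 1
      rw [hopf_one]
      simp only [Complex.ofReal_re, Complex.ofReal_im]
      field_simp
      ring
    · change hopf _ _ 2 = w 2
      rw [hopf_two]
      simp only [Complex.ofReal_re, Complex.ofReal_im]
      have h1 : 2 * w 0 / t * (2 * w 0 / t) + -(2 * w 1 / t) * -(2 * w 1 / t)
          = 2 * (R - w 2) := by
        have : 2 * w 0 / t * (2 * w 0 / t) + -(2 * w 1 / t) * -(2 * w 1 / t)
          = 4 * (w 0 ^ 2 + w 1 ^ 2) / (t * t) := by field_simp; ring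
        rw [this, htt, div_eq_iff (by positivity)]
        linear_combination -4 * hR2
      rw [h1, htt]
      ring

theorem realization_surjective : Function.Surjective (realization (n := n) (m := m)) := by
  intro y
  choose z₁ z₂ hz using fun j => exists_hopf_eq (y.1 j)
  exact ⟨(z₁, z₂, y.2.1, y.2.2), Prod.ext (funext hz) rfl⟩

/-- The sum of the squared norms is read off from `‖J‖`, their difference from the third component.
-/
theorem normSq_add_eq_of_hopf_eq {z₁ z₂ z₁' z₂' : ℂ} (h : hopf z₁ z₂ = hopf z₁' z₂') :
    Complex.normSq z₁ = Complex.normSq z₁' ∧ Complex.normSq z₂ = Complex.normSq z₂' := by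
  have h1 := hopf_dotProduct_self z₁ z₂
  rw [h, hopf_dotProduct_self] at h1
  have h2 := (sq_eq_sq₀ (div_nonneg (add_nonneg (Complex.normSq_nonneg z₁')
    (Complex.normSq_nonneg z₂')) zero_le_four) (div_nonneg (add_nonneg (Complex.normSq_nonneg z₁)
    (Complex.normSq_nonneg z₂)) zero_le_four)).1 h1
  have h3 := congrFun h 2
  simp only [hopf, Matrix.cons_val] at h3
  constructor <;> linarith

theorem mul_star_eq_of_hopf_eq {z₁ z₂ z₁' z₂' : ℂ} (h : hopf z₁ z₂ = hopf z₁' z₂') :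
    z₁ * star z₂ = z₁' * star z₂' := by
  have h1 := congrFun h 0
  have h2 := congrFun h 1
  simp only [hopf, Matrix.cons_val] at h1 h2
  refine Complex.ext ?_ ?_ <;> linarith

/-- Two points in the same fibre of the Hopf map differ by a phase. -/
theorem exists_phase_of_hopf_eq {z₁ z₂ z₁' z₂' : ℂ} (h : hopf z₁ z₂ = hopf z₁' z₂') :
    ∃ θ : ℝ, z₁' = Complex.exp (θ * Complex.I) * z₁ ∧ z₂' = Complex.exp (θ * Complex.I) * z₂ := by
  suffices hg : ∃ g : ℂ, ‖g‖ = 1 ∧ z₁' = g * z₁ ∧ z₂' = g * z₂ by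
    obtain ⟨g, hg, h1, h2⟩ := hg
    obtain ⟨θ, rfl⟩ := (Complex.norm_eq_one_iff g).1 hg
    exact ⟨θ, h1, h2⟩
  obtain ⟨hn1, hn2⟩ := normSq_add_eq_of_hopf_eq h
  have hm := mul_star_eq_of_hopf_eq h
  have hnorm : ∀ {a b : ℂ}, Complex.normSq a = Complex.normSq b → ‖a‖ = ‖b‖ := fun {a b} hab => by
    rw [Complex.normSq_eq_norm_sq, Complex.normSq_eq_norm_sq] at hab
    exact (sq_eq_sq₀ (norm_nonneg a) (norm_nonneg b)).1 hab
  by_cases h1 : z₁ = 0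
  · have h1' : z₁' = 0 := by simpa [h1] using hn1.symm
    by_cases h2 : z₂ = 0
    · have h2' : z₂' = 0 := by simpa [h2] using hn2.symm
      exact ⟨1, by simp, by simp [h1, h1'], by simp [h2, h2']⟩
    · refine ⟨z₂' / z₂, ?_, by simp [h1, h1'], by field_simp⟩
      rw [norm_div, hnorm hn2, div_self]
      rw [← hnorm hn2]
      simpa using h2
  · refine ⟨z₁' / z₁, ?_, by field_simp, ?_⟩
    · rw [norm_div, hnorm hn1, div_self]
      rw [← hnorm hn1]
      simpa using h1
    · have h1' : star z₁ ≠ 0 := star_ne_zero.2 h1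
      have hc : star z₁ * z₂ = star z₁' * z₂' := by simpa [mul_comm] using congrArg star hm
      have hs : z₁ * star z₁ = z₁' * star z₁' := by
        have := congrArg (fun t : ℝ => (t : ℂ)) hn1
        simpa [Complex.mul_conj] using this
      have hz' : z₁' ≠ 0 := by
        rintro rfl
        simp [h1] at hs
      have hz'' : star z₁' ≠ 0 := star_ne_zero.2 hz'
      rw [div_mul_eq_mul_div, eq_div_iff h1]
      apply mul_left_cancel₀ hz''
      -- After multiplication by the conjugate of `z₁'`, both sides are matched through the
      -- invariants `z̄₁z₂` and `|z₁|²`.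
      linear_combination -z₁ * hc + z₂ * hs

/-! ### The torus action -/

/-- The action of `n` phases on `N`. -/
def torusN (g : Fin n → ℂ) (x : SpaceN n m) : SpaceN n m :=
  (fun j => g j * x.1 j, fun j => g j * x.2.1 j, x.2.2.1, x.2.2.2)

/-- The phases `exp (i t θⱼ)`. -/
def phases (θ : Fin n → ℝ) (t : ℝ) : Fin n → ℂ :=
  fun j => Complex.exp ((t * θ j : ℝ) * Complex.I)

theorem norm_phases (θ : Fin n → ℝ) (t : ℝ) (j : Fin n) : ‖phases θ t j‖ = 1 :=
  Complex.norm_exp_ofReal_mul_I _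

theorem continuous_phases (θ : Fin n → ℝ) : Continuous (phases θ) := by
  unfold phases
  fun_prop

theorem torusN_phases_zero (θ : Fin n → ℝ) (x : SpaceN n m) : torusN (phases θ 0) x = x := by
  simp [torusN, phases]

theorem continuous_torusN : Continuous fun a : (Fin n → ℂ) × SpaceN n m => torusN a.1 a.2 := by
  unfold torusN
  fun_prop

theorem realization_torusN {g : Fin n → ℂ} (hg : ∀ j, ‖g j‖ = 1) (x : SpaceN n m) :
    realization (torusN g x) = realization x := by
  refine Prod.ext (funext fun j => ?_) rfl
  have h : g j * star (g j) = 1 := by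
    rw [Complex.star_def, Complex.mul_conj, Complex.normSq_eq_norm_sq, hg]; simp
  have h' : Complex.normSq (g j) = 1 := by rw [Complex.normSq_eq_norm_sq, hg]; simp
  have h2 : g j * x.1 j * star (g j * x.2.1 j) = x.1 j * star (x.2.1 j) := by
    rw [star_mul']; linear_combination x.1 j * star (x.2.1 j) * h
  simp only [realization, torusN, hopf, h2, map_mul, h', one_mul]

/-- Each point of a fibre is reached from `x` along the path `t ↦ phases θ t`, which starts at the
identity; `stages_torusN` continues along this path. -/
theorem exists_torusN_eq {x x' : SpaceN n m} (h : realization x = realization x') :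
    ∃ θ : Fin n → ℝ, x' = torusN (phases θ 1) x := by
  choose θ h1 h2 using fun j => exists_phase_of_hopf_eq (congrFun (congrArg Prod.fst h) j)
  refine ⟨θ, Prod.ext (funext fun j => ?_) (Prod.ext (funext fun j => ?_) ?_)⟩
  · simpa [torusN, phases] using h1 j
  · simpa [torusN, phases] using h2 j
  · exact (congrArg Prod.snd h).symm

/-! ### Topology of the realization -/

@[fun_prop]
theorem contDiff_complex_re {E : Type*} [NormedAddCommGroup E] [NormedSpace ℝ E] {k : WithTop ℕ∞}
    {f : E → ℂ} (hf : ContDiff ℝ k f) : ContDiff ℝ k fun x => (f x).re :=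
  Complex.reCLM.contDiff.comp hf

@[fun_prop]
theorem contDiff_complex_im {E : Type*} [NormedAddCommGroup E] [NormedSpace ℝ E] {k : WithTop ℕ∞}
    {f : E → ℂ} (hf : ContDiff ℝ k f) : ContDiff ℝ k fun x => (f x).im :=
  Complex.imCLM.contDiff.comp hf

@[fun_prop]
theorem contDiff_complex_mk {E : Type*} [NormedAddCommGroup E] [NormedSpace ℝ E]
    {k : WithTop ℕ∞} {f g : E → ℝ} (hf : ContDiff ℝ k f) (hg : ContDiff ℝ k g) :
    ContDiff ℝ k fun x => (⟨f x, g x⟩ : ℂ) := by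
  simp only [Complex.mk_eq_add_mul_I]
  exact (Complex.ofRealCLM.contDiff.comp hf).add
    ((Complex.ofRealCLM.contDiff.comp hg).mul contDiff_const)

theorem contDiff_realization {k : WithTop ℕ∞} :
    ContDiff ℝ k (realization (n := n) (m := m)) := by
  refine ContDiff.prodMk (contDiff_pi.2 fun j => contDiff_pi.2 fun i => ?_) (by fun_prop)
  fin_cases i
  · change ContDiff ℝ k fun x : SpaceN n m => hopf (x.1 j) (x.2.1 j) 0
    simp only [hopf_zero]; fun_prop
  · change ContDiff ℝ k fun x : SpaceN n m => hopf (x.1 j) (x.2.1 j) 1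
    simp only [hopf_one]; fun_prop
  · change ContDiff ℝ k fun x : SpaceN n m => hopf (x.1 j) (x.2.1 j) 2
    simp only [hopf_two]; fun_prop

theorem continuous_realization : Continuous (realization (n := n) (m := m)) :=
  (contDiff_realization (k := 0)).continuous

/-- A sup-norm bound gives `‖J‖² ≤ 3R² ≤ (2R)²`, hence `|z₁|² + |z₂|² ≤ 8R`, and `8R ≤ (8R)²` since
`R ≥ 1`. -/
theorem norm_le_of_hopf {z₁ z₂ : ℂ} {R : ℝ} (hR : 1 ≤ R) (h : ‖hopf z₁ z₂‖ ≤ R) :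
    ‖z₁‖ ≤ 8 * R ∧ ‖z₂‖ ≤ 8 * R := by
  have h0 := (pi_norm_le_iff_of_nonneg (by linarith)).1 h
  have hk : ∀ k, hopf z₁ z₂ k * hopf z₁ z₂ k ≤ R ^ 2 := fun k => by
    rw [← sq, ← sq_abs]
    exact pow_le_pow_left₀ (abs_nonneg _) (h0 k) 2
  have h1 := hopf_dotProduct_self z₁ z₂
  simp only [dotProduct, Fin.sum_univ_three] at h1
  have h2 : ((Complex.normSq z₁ + Complex.normSq z₂) / 4) ^ 2 ≤ (2 * R) ^ 2 := by
    rw [← h1]; nlinarith [hk 0, hk 1, hk 2]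
  have h4 := (abs_le.1 (abs_le_of_sq_le_sq h2 (by linarith))).2
  have h5 := Complex.normSq_nonneg z₁
  have h6 := Complex.normSq_nonneg z₂
  rw [Complex.normSq_eq_norm_sq] at h4 h5 h6
  rw [Complex.normSq_eq_norm_sq] at h4
  constructor
  · exact le_of_sq_le_sq (by nlinarith) (by linarith)
  · exact le_of_sq_le_sq (by nlinarith) (by linarith)

theorem isCompact_realization_preimage {C : Set (SpaceP n m)} (hC : IsCompact C) :
    IsCompact (realization ⁻¹' C) := by
  refine Metric.isCompact_of_isClosed_isBounded (hC.isClosed.preimage continuous_realization) ?_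
  obtain ⟨R, hR⟩ := hC.isBounded.exists_norm_le
  refine isBounded_iff_forall_norm_le.2 ⟨8 * max R 1, fun x hx => ?_⟩
  have h1 : ‖realization x‖ ≤ max R 1 := (hR _ hx).trans (le_max_left _ _)
  have hR1 : 1 ≤ max R 1 := le_max_right _ _
  have h2 : ∀ j, ‖hopf (x.1 j) (x.2.1 j)‖ ≤ max R 1 := fun j =>
    (norm_le_pi_norm (realization x).1 j).trans ((norm_fst_le _).trans h1)
  have h3 : ‖x.2.2‖ ≤ max R 1 := (norm_snd_le (realization x)).trans h1
  refine norm_prod_le_iff.2 ⟨?_, norm_prod_le_iff.2 ⟨?_, by linarith⟩⟩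
  · exact (pi_norm_le_iff_of_nonneg (by linarith)).2 fun j => (norm_le_of_hopf hR1 (h2 j)).1
  · exact (pi_norm_le_iff_of_nonneg (by linarith)).2 fun j => (norm_le_of_hopf hR1 (h2 j)).2

theorem isClosedMap_realization : IsClosedMap (realization (n := n) (m := m)) :=
  (isProperMap_iff_isCompact_preimage.2
    ⟨continuous_realization, fun _ hC => isCompact_realization_preimage hC⟩).isClosedMap

/-- As a closed continuous surjection, `ψ` is a quotient map, and the saturation of an open set is a
union of torus translates. Openness transfers statements near `x` to statements near `ψ(x)`, even
where `ψ` is not a submersion. -/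
theorem isOpenMap_realization : IsOpenMap (realization (n := n) (m := m)) := by
  intro O hO
  have hq := isClosedMap_realization (n := n) (m := m).isQuotientMap continuous_realization
    realization_surjective
  rw [← hq.isOpen_preimage]
  have h : realization ⁻¹' (realization '' O) =
      ⋃ θ : Fin n → ℝ, torusN (m := m) (phases θ 1) ⁻¹' O := by
    ext x
    simp only [Set.mem_preimage, Set.mem_image, Set.mem_iUnion]
    constructor
    · rintro ⟨x', hx', h⟩
      obtain ⟨θ, rfl⟩ := exists_torusN_eq h.symm
      exact ⟨θ, hx'⟩
    · rintro ⟨θ, hθ⟩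
      exact ⟨_, hθ, realization_torusN (norm_phases θ 1) x⟩
  rw [h]
  exact isOpen_iUnion fun θ =>
    hO.preimage (continuous_torusN.comp (Continuous.prodMk_right (phases θ 1)))

/-! ### Left multiplication by quaternions -/

/-- The action of `c ∈ N` on `x ∈ N`: the pair `(c₁, c₂)`, read as the quaternion with matrix
`!![c₁, -c̄₂; c₂, c̄₁]`, multiplies `(z₁, z₂)`; the remaining components are those of `c`. -/
def actN (c x : SpaceN n m) : SpaceN n m :=
  (fun j => c.1 j * x.1 j - star (c.2.1 j) * x.2.1 j,
   fun j => c.2.1 j * x.1 j + star (c.1 j) * x.2.1 j, c.2.2.1, c.2.2.2)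

/-- The action on `P` which corresponds to `actN`: quaternions act on `ℝ³` by conjugation. -/
def actP (c : SpaceN n m) (y : SpaceP n m) : SpaceP n m :=
  (fun j =>
    ![((c.1 j).re ^ 2 - (c.1 j).im ^ 2 - (c.2.1 j).re ^ 2 + (c.2.1 j).im ^ 2) * y.1 j 0
        + (2 * (c.2.1 j).re * (c.2.1 j).im - 2 * (c.1 j).re * (c.1 j).im) * y.1 j 1
        + 2 * ((c.1 j).re * (c.2.1 j).re + (c.1 j).im * (c.2.1 j).im) * y.1 j 2,
      (2 * (c.1 j).re * (c.1 j).im + 2 * (c.2.1 j).re * (c.2.1 j).im) * y.1 j 0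
        + ((c.1 j).re ^ 2 - (c.1 j).im ^ 2 + (c.2.1 j).re ^ 2 - (c.2.1 j).im ^ 2) * y.1 j 1
        + 2 * ((c.1 j).im * (c.2.1 j).re - (c.1 j).re * (c.2.1 j).im) * y.1 j 2,
      -2 * ((c.1 j).re * (c.2.1 j).re - (c.1 j).im * (c.2.1 j).im) * y.1 j 0
        + 2 * ((c.1 j).re * (c.2.1 j).im + (c.1 j).im * (c.2.1 j).re) * y.1 j 1
        + ((c.1 j).re ^ 2 + (c.1 j).im ^ 2 - (c.2.1 j).re ^ 2 - (c.2.1 j).im ^ 2) * y.1 j 2],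
   c.2.2.1, c.2.2.2)

/-- The identity quaternions, with the `T*ℝᵐ`-component of `y`. -/
def unitN (y : SpaceP n m) : SpaceN n m := (fun _ => 1, fun _ => 0, y.2.1, y.2.2)

/-- The imaginary quaternions given by `v`, acting on the `z`-components of `x`, together with the
`T*ℝᵐ`-component of `v`. -/
def liftN (v : SpaceP n m) (x : SpaceN n m) : SpaceN n m :=
  (fun j => ⟨(-v.1 j 2 * (x.1 j).im - v.1 j 0 * (x.2.1 j).im - v.1 j 1 * (x.2.1 j).re) / 2,
      (v.1 j 2 * (x.1 j).re + v.1 j 0 * (x.2.1 j).re - v.1 j 1 * (x.2.1 j).im) / 2⟩,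
   fun j => ⟨(-v.1 j 0 * (x.1 j).im + v.1 j 1 * (x.1 j).re + v.1 j 2 * (x.2.1 j).im) / 2,
      (v.1 j 0 * (x.1 j).re + v.1 j 1 * (x.1 j).im - v.1 j 2 * (x.2.1 j).re) / 2⟩,
   v.2.1, v.2.2)

/-- Left multiplication of `z` by a quaternion induces on `J(z)` the conjugation by it, scaled by
its squared norm. Hence the image of `c · x` depends on `x` only through `ψ(x)`. -/
theorem realization_actN (c x : SpaceN n m) :
    realization (actN c x) = actP c (realization x) := by
  refine Prod.ext (funext fun j => funext fun k => ?_) rfl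
  fin_cases k
  · change hopf _ _ 0 = _
    simp [hopf_zero, actP, realization, actN, hopf_one, hopf_two]
    ring
  · change hopf _ _ 1 = _
    simp [hopf_zero, actP, realization, actN, hopf_one, hopf_two]
    ring
  · change hopf _ _ 2 = _
    simp [hopf_zero, actP, realization, actN, hopf_one, hopf_two]
    ring

/-- Associativity of quaternion multiplication, since `liftN v` multiplies from the left on the
`z`-components. -/
theorem actN_liftN (v : SpaceP n m) (c x : SpaceN n m) :
    actN (liftN v c) x = liftN v (actN c x) := by
  refine Prod.ext (funext fun j => ?_) (Prod.ext (funext fun j => ?_) rfl) <;>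
    refine Complex.ext ?_ ?_ <;> simp [actN, liftN] <;> ring

theorem actN_unitN (x : SpaceN n m) : actN (unitN (realization x)) x = x := by
  simp [actN, unitN, realization]

theorem actN_scaleN (α β γ : ℝ) (c x : SpaceN n m) :
    actN (scaleN α β γ c) x = scaleN α β γ (actN c x) := by
  refine Prod.ext (funext fun j => ?_) (Prod.ext (funext fun j => ?_) rfl) <;>
    refine Complex.ext ?_ ?_ <;> simp [actN, scaleN] <;> ring

/-- Left multiplication by a quaternion is complex linear on `ℂ²`, so it commutes with a common
phase. -/
theorem torusN_liftN (g : Fin n → ℂ) (v : SpaceP n m) (x : SpaceN n m) :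
    torusN g (liftN v x) = liftN v (torusN g x) := by
  refine Prod.ext (funext fun j => ?_) (Prod.ext (funext fun j => ?_) rfl) <;>
    refine Complex.ext ?_ ?_ <;> simp [torusN, liftN] <;> ring

theorem torusN_scaleN (g : Fin n → ℂ) (α β γ : ℝ) (x : SpaceN n m) :
    torusN g (scaleN α β γ x) = scaleN α β γ (torusN g x) := by
  refine Prod.ext (funext fun j => ?_) (Prod.ext (funext fun j => ?_) rfl) <;>
    simp [torusN, scaleN, mul_left_comm]

/-- `torusN g` as a linear map. -/
def torusL (g : Fin n → ℂ) : SpaceN n m →ₗ[ℝ] SpaceN n m where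
  toFun := torusN g
  map_add' x x' := by
    refine Prod.ext (funext fun j => ?_) (Prod.ext (funext fun j => ?_) rfl) <;>
      simp [torusN, mul_add]
  map_smul' a x := by
    refine Prod.ext (funext fun j => ?_) (Prod.ext (funext fun j => ?_) rfl) <;>
      simp [torusN, mul_left_comm]

/-- `c ↦ actN c x` as a linear map. -/
def actL (x : SpaceN n m) : SpaceN n m →L[ℝ] SpaceN n m :=
  LinearMap.toContinuousLinearMap
    { toFun := fun c => actN c x
      map_add' := fun c c' => by
        refine Prod.ext (funext fun j => ?_) (Prod.ext (funext fun j => ?_) rfl) <;>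
          simp [actN] <;> ring
      map_smul' := fun a c => by
        refine Prod.ext (funext fun j => ?_) (Prod.ext (funext fun j => ?_) rfl) <;>
          simp [actN] <;> ring }

theorem actL_apply (x c : SpaceN n m) : actL x c = actN c x := rfl

theorem liftN_add_smul (v : SpaceP n m) (x δ : SpaceN n m) (t : ℝ) :
    liftN v (x + t • δ) = liftN v x + t • liftN (v.1, 0) δ := by
  refine Prod.ext (funext fun j => ?_) (Prod.ext (funext fun j => ?_) ?_)
  · refine Complex.ext ?_ ?_ <;> simp [liftN] <;> ring
  · refine Complex.ext ?_ ?_ <;> simp [liftN] <;> ring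
  · simp [liftN]

/-- The quaternion norm is multiplicative, so there are no zero divisors. -/
theorem eq_zero_or_eq_zero_of_quaternion_mul {c₁ c₂ z₁ z₂ : ℂ} (h₁ : c₁ * z₁ - star c₂ * z₂ = 0)
    (h₂ : c₂ * z₁ + star c₁ * z₂ = 0) : (c₁ = 0 ∧ c₂ = 0) ∨ (z₁ = 0 ∧ z₂ = 0) := by
  have h : (Complex.normSq c₁ + Complex.normSq c₂) * (Complex.normSq z₁ + Complex.normSq z₂) = 0 := by
    have : (Complex.normSq c₁ + Complex.normSq c₂) * (Complex.normSq z₁ + Complex.normSq z₂) =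
        Complex.normSq (c₁ * z₁ - star c₂ * z₂) + Complex.normSq (c₂ * z₁ + star c₁ * z₂) := by
      simp [Complex.normSq_apply]; ring
    rw [this, h₁, h₂]; simp
  have h0 : ∀ a b : ℂ, Complex.normSq a + Complex.normSq b = 0 → a = 0 ∧ b = 0 := fun a b hab =>
    ⟨Complex.normSq_eq_zero.1 (by linarith [Complex.normSq_nonneg a, Complex.normSq_nonneg b]),
      Complex.normSq_eq_zero.1 (by linarith [Complex.normSq_nonneg a, Complex.normSq_nonneg b])⟩
  exact (mul_eq_zero.1 h).imp (h0 _ _) (h0 _ _)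

theorem of_actN_eq_zero {δ x : SpaceN n m} (h : actN δ x = 0) :
    (∀ j, (δ.1 j = 0 ∧ δ.2.1 j = 0) ∨ (x.1 j = 0 ∧ x.2.1 j = 0)) ∧ δ.2.2 = 0 :=
  ⟨fun j => eq_zero_or_eq_zero_of_quaternion_mul (congrFun (congrArg Prod.fst h) j)
      (congrFun (congrArg (fun a => a.2.1) h) j),
    congrArg (fun a => a.2.2) h⟩

theorem exists_actN_eq {x y : SpaceN n m}
    (h : ∀ j, x.1 j = 0 → x.2.1 j = 0 → y.1 j = 0 ∧ y.2.1 j = 0) : ∃ c, actN c x = y := by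
  have hj : ∀ j, ∃ c : ℂ × ℂ, c.1 * x.1 j - star c.2 * x.2.1 j = y.1 j ∧
      c.2 * x.1 j + star c.1 * x.2.1 j = y.2.1 j := by
    intro j
    by_cases h0 : x.1 j = 0 ∧ x.2.1 j = 0
    · obtain ⟨h1, h2⟩ := h j h0.1 h0.2
      exact ⟨0, by simp [h1], by simp [h2]⟩
    · have hN : Complex.normSq (x.1 j) + Complex.normSq (x.2.1 j) ≠ 0 := fun hN => h0
        ⟨Complex.normSq_eq_zero.1
          (by linarith [Complex.normSq_nonneg (x.1 j), Complex.normSq_nonneg (x.2.1 j)]),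
          Complex.normSq_eq_zero.1
          (by linarith [Complex.normSq_nonneg (x.1 j), Complex.normSq_nonneg (x.2.1 j)])⟩
      have hNc : x.1 j * star (x.1 j) + x.2.1 j * star (x.2.1 j) =
          ((Complex.normSq (x.1 j) + Complex.normSq (x.2.1 j) : ℝ) : ℂ) := by
        simp [Complex.mul_conj]
      generalize Complex.normSq (x.1 j) + Complex.normSq (x.2.1 j) = N at hN hNc
      have hN' : (N : ℂ) ≠ 0 := Complex.ofReal_ne_zero.2 hN
      have hs : star (N : ℂ) = N := Complex.conj_ofReal N
      -- The quaternion quotient `y x̄ / |x|²`, written in complex components.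
      refine ⟨((y.1 j * star (x.1 j) + star (y.2.1 j) * x.2.1 j) / N,
        (y.2.1 j * star (x.1 j) - star (y.1 j) * x.2.1 j) / N), ?_, ?_⟩
      · simp only [star_div₀, hs, star_sub, star_mul', star_star]
        field_simp
        linear_combination y.1 j * hNc
      · simp only [star_div₀, hs, star_add, star_mul', star_star]
        field_simp
        linear_combination y.2.1 j * hNc
  choose c h1 h2 using hj
  exact ⟨(fun j => (c j).1, fun j => (c j).2, y.2.2),
    Prod.ext (funext h1) (Prod.ext (funext h2) rfl)⟩

theorem contDiff_actP {k : WithTop ℕ∞} :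
    ContDiff ℝ k fun a : SpaceN n m × SpaceP n m => actP a.1 a.2 := by
  refine ContDiff.prodMk (contDiff_pi.2 fun j => contDiff_pi.2 fun i => ?_) (by fun_prop)
  fin_cases i <;> simp only [Fin.zero_eta, Fin.mk_one, Fin.reduceFinMk, Matrix.cons_val] <;> fun_prop

theorem contDiff_liftN {k : WithTop ℕ∞} :
    ContDiff ℝ k fun a : SpaceP n m × SpaceN n m => liftN a.1 a.2 := by
  unfold liftN
  fun_prop

theorem continuous_actN : Continuous fun a : SpaceN n m × SpaceN n m => actN a.1 a.2 := by
  unfold actN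
  fun_prop

/-! ### The differential of the realization -/

/-- The derivative of a map which is quadratic along a line. -/
theorem fderiv_apply_of_quadratic {E F : Type*} [NormedAddCommGroup E] [NormedSpace ℝ E]
    [NormedAddCommGroup F] [NormedSpace ℝ F] {f : E → F} {x ξ : E} {a b : F}
    (hf : DifferentiableAt ℝ f x) (h : ∀ t : ℝ, f (x + t • ξ) = f x + t • a + t ^ 2 • b) :
    fderiv ℝ f x ξ = a := by
  have h1 : HasDerivAt (fun t : ℝ => f (x + t • ξ)) (fderiv ℝ f x ξ) 0 :=
    hf.hasFDerivAt.hasLineDerivAt ξ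
  have h2 : HasDerivAt (fun t : ℝ => f x + t • a + t ^ 2 • b) a 0 := by
    have h3 := ((hasDerivAt_const (0 : ℝ) (f x)).add ((hasDerivAt_id (0 : ℝ)).smul_const a)).add
      ((hasDerivAt_pow 2 (0 : ℝ)).smul_const b)
    exact h3.congr_deriv (by simp)
  simp only [h] at h1
  exact h1.unique h2

/-- The differential of the Hopf map at `(z₁, z₂)`. -/
def dHopf (z₁ z₂ ζ₁ ζ₂ : ℂ) : Fin 3 → ℝ :=
  ![(z₁.re * ζ₂.re + ζ₁.re * z₂.re + z₁.im * ζ₂.im + ζ₁.im * z₂.im) / 2,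
    (z₁.im * ζ₂.re + ζ₁.im * z₂.re - z₁.re * ζ₂.im - ζ₁.re * z₂.im) / 2,
    (z₁.re * ζ₁.re + z₁.im * ζ₁.im - z₂.re * ζ₂.re - z₂.im * ζ₂.im) / 2]

/-- The differential of the realization. -/
def dRealization (x ξ : SpaceN n m) : SpaceP n m :=
  (fun j => dHopf (x.1 j) (x.2.1 j) (ξ.1 j) (ξ.2.1 j), ξ.2.2)

theorem fderiv_realization (x ξ : SpaceN n m) :
    fderiv ℝ realization x ξ = dRealization x ξ := by
  refine fderiv_apply_of_quadratic (b := (fun j => hopf (ξ.1 j) (ξ.2.1 j), 0))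
    (contDiff_realization.differentiable one_ne_zero x) fun t => ?_
  refine Prod.ext (funext fun j => funext fun k => ?_) ?_
  · fin_cases k
    · change hopf _ _ 0 = hopf _ _ 0 + t • dHopf _ _ _ _ 0 + t ^ 2 • hopf _ _ 0
      simp [hopf_zero, dHopf]; ring
    · change hopf _ _ 1 = hopf _ _ 1 + t • dHopf _ _ _ _ 1 + t ^ 2 • hopf _ _ 1
      simp [hopf_one, dHopf]; ring
    · change hopf _ _ 2 = hopf _ _ 2 + t • dHopf _ _ _ _ 2 + t ^ 2 • hopf _ _ 2
      simp [hopf_two, dHopf]; ring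
  · refine Prod.ext ?_ ?_ <;> simp [realization, dRealization]

/-! ### Pulled-back Hamiltonian systems -/

/-- The coefficients `(∂/∂w, -∂/∂q, ∂/∂p)` of a covector on `P`. -/
def coeffP : (SpaceP n m →L[ℝ] ℝ) →L[ℝ] SpaceP n m :=
  LinearMap.toContinuousLinearMap
    { toFun := fun α =>
        (fun j k => α (Pi.single j (Pi.single k 1), 0, 0),
         fun i => -α (0, 0, Pi.single i 1),
         fun i => α (0, Pi.single i 1, 0))
      map_add' := fun α β => by
        ext <;> simp [add_comm]
      map_smul' := fun c α => by
        ext <;> simp }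

theorem covectorP_apply (α : SpaceP n m →L[ℝ] ℝ) (u : SpaceP n m) :
    α u = (∑ i, (u.2.1 i * (coeffP α).2.2 i - u.2.2 i * (coeffP α).2.1 i))
      + ∑ j, u.1 j ⬝ᵥ (coeffP α).1 j := by
  have hu : u = (∑ i, (u.2.1 i • ((0, Pi.single i 1, 0) : SpaceP n m)
          + u.2.2 i • ((0, 0, Pi.single i 1) : SpaceP n m)))
      + ∑ j, ∑ k, u.1 j k • ((Pi.single j (Pi.single k 1), 0, 0) : SpaceP n m) := by
    ext j k
    · simp only [Prod.fst_add, Prod.fst_sum, Prod.smul_fst, smul_zero, add_zero,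
        Finset.sum_const_zero, zero_add, Finset.sum_apply, Pi.smul_apply, Pi.single_apply,
        smul_eq_mul]
      rw [Finset.sum_eq_single j]
      · simp [Pi.single_apply]
      · intro j' _ hj'
        simp [Ne.symm hj']
      · simp
    · simp [Prod.fst_sum, Prod.snd_sum, Finset.sum_apply, Pi.single_apply]
    · simp [Prod.snd_sum, Finset.sum_apply, Pi.single_apply]
  conv_lhs => rw [hu]
  simp only [map_add, map_sum, map_smul, smul_eq_mul]
  simp [coeffP, dotProduct]

/-- The transpose of `dψ` followed by `sharpN` is left multiplication by the imaginary quaternion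
with coefficients `∂/∂w`. All equivariance of pulled-back systems comes from this form. -/
theorem sharpN_comp_fderiv_realization (α : SpaceP n m →L[ℝ] ℝ) (x : SpaceN n m) :
    sharpN (α.comp (fderiv ℝ realization x)) = liftN (coeffP α) x := by
  refine omegaN_right_ext fun ξ => ?_
  rw [omegaN_sharpN, ContinuousLinearMap.comp_apply, fderiv_realization, covectorP_apply, omegaN,
    ← Finset.sum_add_distrib, add_comm]
  congr 1
  · refine Finset.sum_congr rfl fun j _ => ?_
    simp [dRealization, dHopf, liftN, dotProduct, Fin.sum_univ_three]
    ring
  · refine Finset.sum_congr rfl fun i _ => ?_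
    simp [dRealization, liftN]
    ring

theorem hamVectorField_comp_realization {H : SpaceP n m → ℝ} {x : SpaceN n m}
    (hH : DifferentiableAt ℝ H (realization x)) :
    hamVectorField (H ∘ realization) x = liftN (coeffP (fderiv ℝ H (realization x))) x := by
  rw [hamVectorField_eq, fderiv_comp x hH (contDiff_realization.differentiable one_ne_zero x),
    sharpN_comp_fderiv_realization]

/-! ### The realization is a Poisson map -/

/-- Infinitesimal conjugation by an imaginary quaternion is a rotation, hence a cross product. -/
theorem dRealization_liftN (v : SpaceP n m) (x : SpaceN n m) :
    dRealization x (liftN v x) = (fun j => v.1 j ⨯₃ (realization x).1 j, v.2) := by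
  refine Prod.ext (funext fun j => funext fun k => ?_) rfl
  fin_cases k <;>
    simp [dRealization, dHopf, liftN, realization, crossProduct, hopf_zero, hopf_one, hopf_two] <;>
    ring

/-- The Poisson tensor of `P`. -/
def tensorP (y : SpaceP n m) (α β : SpaceP n m →L[ℝ] ℝ) : ℝ :=
  (∑ i, (α (0, 0, Pi.single i 1) * β (0, Pi.single i 1, 0)
      - α (0, Pi.single i 1, 0) * β (0, 0, Pi.single i 1)))
    + ∑ j, y.1 j ⬝ᵥ ((coeffP α).1 j ⨯₃ (coeffP β).1 j)

theorem poissonBracket_eq_tensorP (f g : SpaceP n m → ℝ) (y : SpaceP n m) :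
    poissonBracket f g y = tensorP y (fderiv ℝ f y) (fderiv ℝ g y) := rfl

/-- This says that `ψ` is a Poisson map. The right side is `α` applied to `dψ` of the lift of `β`,
which is a cross product with `w`; cyclic symmetry of the triple product gives the bracket. -/
theorem tensorP_realization (x : SpaceN n m) (α β : SpaceP n m →L[ℝ] ℝ) :
    tensorP (realization x) α β =
      omegaN (sharpN (α.comp (fderiv ℝ realization x)))
        (sharpN (β.comp (fderiv ℝ realization x))) := by
  rw [omegaN_sharpN, ContinuousLinearMap.comp_apply, sharpN_comp_fderiv_realization,
    fderiv_realization, dRealization_liftN, covectorP_apply, tensorP]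
  congr 1
  · refine Finset.sum_congr rfl fun i _ => ?_
    simp [coeffP]
    ring
  · refine Finset.sum_congr rfl fun j _ => ?_
    simp only [dotProduct, Fin.sum_univ_three, cross_apply, Matrix.cons_val]
    ring

/-- The pull-back by a linear symplectic map preserves the Poisson tensor of `N`. -/
theorem omegaN_sharpN_comp {A : SpaceN n m →L[ℝ] SpaceN n m}
    (hA : ∀ u v, omegaN (A u) (A v) = omegaN u v) (α β : SpaceN n m →L[ℝ] ℝ) :
    omegaN (sharpN (α.comp A)) (sharpN (β.comp A)) = omegaN (sharpN α) (sharpN β) := by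
  -- Preserving a nondegenerate form forces injectivity, and equality of dimensions then gives
  -- surjectivity.
  have hinj : Function.Injective (A : SpaceN n m →ₗ[ℝ] SpaceN n m) := by
    intro u u' h
    refine omegaN_right_ext fun v => ?_
    have h' : A u = A u' := h
    rw [← hA u v, h', hA]
  have hsurj := LinearMap.surjective_of_injective hinj
  have h1 : A (sharpN (β.comp A)) = sharpN β := by
    refine omegaN_right_ext fun v => ?_
    obtain ⟨v, rfl⟩ := hsurj v
    change omegaN _ (A v) = omegaN _ (A v)
    rw [hA, omegaN_sharpN, omegaN_sharpN, ContinuousLinearMap.comp_apply]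
  rw [omegaN_sharpN, ContinuousLinearMap.comp_apply, h1, omegaN_sharpN]

section Descent

variable {Φ : SpaceN n m → SpaceN n m} {φ : SpaceP n m → SpaceP n m} {x : SpaceN n m}

theorem fderiv_descent (hφ : DifferentiableAt ℝ φ (realization x)) (hΦ : DifferentiableAt ℝ Φ x)
    (h : (fun x => φ (realization x)) =ᶠ[𝓝 x] fun x => realization (Φ x)) :
    (fderiv ℝ φ (realization x)).comp (fderiv ℝ realization x) =
      (fderiv ℝ realization (Φ x)).comp (fderiv ℝ Φ x) := by
  have hψ : Differentiable ℝ (realization (n := n) (m := m)) :=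
    contDiff_realization.differentiable one_ne_zero
  rw [← fderiv_comp x hφ (hψ x), ← fderiv_comp x (hψ _) hΦ]
  exact h.fderiv_eq

/-- A map of `P` covered by a symplectic map of `N` is a Poisson map. -/
theorem poissonBracket_comp_of_descent (hφ : DifferentiableAt ℝ φ (realization x))
    (hΦ : DifferentiableAt ℝ Φ x)
    (hsymp : ∀ u v, omegaN (fderiv ℝ Φ x u) (fderiv ℝ Φ x v) = omegaN u v)
    (h : (fun x => φ (realization x)) =ᶠ[𝓝 x] fun x => realization (Φ x))
    {f g : SpaceP n m → ℝ} (hf : DifferentiableAt ℝ f (φ (realization x)))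
    (hg : DifferentiableAt ℝ g (φ (realization x))) :
    poissonBracket (f ∘ φ) (g ∘ φ) (realization x) = poissonBracket f g (φ (realization x)) := by
  have hx : φ (realization x) = realization (Φ x) := h.self_of_nhds
  rw [poissonBracket_eq_tensorP, poissonBracket_eq_tensorP, tensorP_realization,
    fderiv_comp _ hf hφ, fderiv_comp _ hg hφ, ContinuousLinearMap.comp_assoc,
    ContinuousLinearMap.comp_assoc, fderiv_descent hφ hΦ h, ← ContinuousLinearMap.comp_assoc,
    ← ContinuousLinearMap.comp_assoc, omegaN_sharpN_comp hsymp, hx, tensorP_realization]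

end Descent

/-! ### Reduction to the leaf `M` -/

theorem hopf_dotProduct_dHopf (z₁ z₂ ζ₁ ζ₂ : ℂ) :
    hopf z₁ z₂ ⬝ᵥ dHopf z₁ z₂ ζ₁ ζ₂ =
      (Complex.normSq z₁ + Complex.normSq z₂) / 8 *
        (z₁.re * ζ₁.re + z₁.im * ζ₁.im + z₂.re * ζ₂.re + z₂.im * ζ₂.im) := by
  simp only [dotProduct, Fin.sum_univ_three, hopf_zero, hopf_one, hopf_two, dHopf,
    Matrix.cons_val, Complex.normSq_apply]
  ring

theorem normSq_add_normSq_of_hopf_unit {z₁ z₂ : ℂ} (h : hopf z₁ z₂ ⬝ᵥ hopf z₁ z₂ = 1) :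
    Complex.normSq z₁ + Complex.normSq z₂ = 4 := by
  rw [hopf_dotProduct_self] at h
  nlinarith [Complex.normSq_nonneg z₁, Complex.normSq_nonneg z₂]

/-- In general the area form pulls back to `N²/16` times the symplectic form, with `N = |z₁|² +
|z₂|²`, plus terms containing the radial part of `ζ` or `η`. Tangency of the images kills the radial
parts, and `N = 4` over the unit sphere. -/
theorem area_dHopf {z₁ z₂ ζ₁ ζ₂ η₁ η₂ : ℂ} (h : hopf z₁ z₂ ⬝ᵥ hopf z₁ z₂ = 1)
    (hζ : hopf z₁ z₂ ⬝ᵥ dHopf z₁ z₂ ζ₁ ζ₂ = 0) (hη : hopf z₁ z₂ ⬝ᵥ dHopf z₁ z₂ η₁ η₂ = 0) :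
    hopf z₁ z₂ ⬝ᵥ (dHopf z₁ z₂ ζ₁ ζ₂ ⨯₃ dHopf z₁ z₂ η₁ η₂) =
      (ζ₁.im * η₁.re - ζ₁.re * η₁.im) + (ζ₂.im * η₂.re - ζ₂.re * η₂.im) := by
  have hN := normSq_add_normSq_of_hopf_unit h
  rw [hopf_dotProduct_dHopf, hN] at hζ hη
  have h1 : hopf z₁ z₂ ⬝ᵥ (dHopf z₁ z₂ ζ₁ ζ₂ ⨯₃ dHopf z₁ z₂ η₁ η₂) =
      (Complex.normSq z₁ + Complex.normSq z₂) / 16 *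
        ((Complex.normSq z₁ + Complex.normSq z₂) *
            ((ζ₁.im * η₁.re - ζ₁.re * η₁.im) + (ζ₂.im * η₂.re - ζ₂.re * η₂.im))
          + ((z₁.re * ζ₁.re + z₁.im * ζ₁.im + z₂.re * ζ₂.re + z₂.im * ζ₂.im)
              * (z₁.re * η₁.im - z₁.im * η₁.re + z₂.re * η₂.im - z₂.im * η₂.re)
            - (z₁.re * ζ₁.im - z₁.im * ζ₁.re + z₂.re * ζ₂.im - z₂.im * ζ₂.re)
              * (z₁.re * η₁.re + z₁.im * η₁.im + z₂.re * η₂.re + z₂.im * η₂.im))) := by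
    simp only [dotProduct, Fin.sum_univ_three, cross_apply, hopf_zero, hopf_one, hopf_two, dHopf,
      Matrix.cons_val, Complex.normSq_apply]
    ring
  rw [h1, hN]
  linear_combination (1 / 2) * (z₁.re * η₁.im - z₁.im * η₁.re + z₂.re * η₂.im - z₂.im * η₂.re) * hζ
    - (1 / 2) * (z₁.re * ζ₁.im - z₁.im * ζ₁.re + z₂.re * ζ₂.im - z₂.im * ζ₂.re) * hη

theorem omegaM_dRealization {x ξ η : SpaceN n m} (hx : realization x ∈ spaceM n m)
    (hξ : dRealization x ξ ∈ tangentM (realization x))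
    (hη : dRealization x η ∈ tangentM (realization x)) :
    omegaM (realization x) (dRealization x ξ) (dRealization x η) = omegaN ξ η := by
  rw [omegaM, omegaN, add_comm, ← Finset.sum_add_distrib]
  congr 1
  exact Finset.sum_congr rfl fun j _ => area_dHopf (hx j) (hξ j) (hη j)

/-- For a unit vector `w` and `u ⊥ w` one has `(w × u) × w = u`, so the lift of `w × u` is mapped to
`u`. -/
theorem exists_dRealization_eq {x : SpaceN n m} (hx : realization x ∈ spaceM n m)
    {u : SpaceP n m} (hu : u ∈ tangentM (realization x)) : ∃ ξ, dRealization x ξ = u := by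
  refine ⟨liftN (fun j => (realization x).1 j ⨯₃ u.1 j, u.2) x, ?_⟩
  rw [dRealization_liftN]
  refine Prod.ext (funext fun j => ?_) rfl
  have h1 := hx j
  have h2 := hu j
  simp only [dotProduct, Fin.sum_univ_three] at h1 h2
  funext k
  fin_cases k
  · simp [cross_apply]
    linear_combination u.1 j 0 * h1 - (realization x).1 j 0 * h2
  · simp [cross_apply]
    linear_combination u.1 j 1 * h1 - (realization x).1 j 1 * h2
  · simp [cross_apply]
    linear_combination u.1 j 2 * h1 - (realization x).1 j 2 * h2

/-- Differentiate the conserved quantity `‖w_j‖²` along `u`. -/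
theorem fderiv_mem_tangentM {φ : SpaceP n m → SpaceP n m} {y u : SpaceP n m}
    (hφ : DifferentiableAt ℝ φ y)
    (h : ∀ᶠ y' in 𝓝 y, ∀ j, (φ y').1 j ⬝ᵥ (φ y').1 j = y'.1 j ⬝ᵥ y'.1 j) (hu : u ∈ tangentM y) :
    fderiv ℝ φ y u ∈ tangentM (φ y) := by
  intro j
  let L : Fin 3 → SpaceP n m →L[ℝ] ℝ := fun k =>
    (ContinuousLinearMap.proj (R := ℝ) (φ := fun _ => ℝ) k).comp
      ((ContinuousLinearMap.proj (R := ℝ) (φ := fun _ => Fin 3 → ℝ) j).comp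
        (ContinuousLinearMap.fst ℝ _ _))
  have hc : ∀ k, HasFDerivAt (fun y : SpaceP n m => y.1 j k) (L k) y := fun k => (L k).hasFDerivAt
  have hc' : ∀ k, HasFDerivAt (fun y : SpaceP n m => (φ y).1 j k) ((L k).comp (fderiv ℝ φ y)) y :=
    fun k => (L k).hasFDerivAt.comp y hφ.hasFDerivAt
  have h1 := HasFDerivAt.fun_sum (u := Finset.univ) fun k _ => (hc k).mul (hc k)
  have h2 := HasFDerivAt.fun_sum (u := Finset.univ) fun k _ => (hc' k).mul (hc' k)
  have h3 := congrArg (fun L => L u) (h2.unique (h1.congr_of_eventuallyEq (h.mono fun y' hy' => hy' j)))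
  have h4 := hu j
  simp only [dotProduct, Fin.sum_univ_three] at h4
  simp [Fin.sum_univ_three, L] at h3
  simp only [dotProduct, Fin.sum_univ_three]
  linarith

/-- Both tangent vectors lift to `N`. There `omegaM` becomes `omegaN`, at the source and at the
target, and `Φ` preserves `omegaN`. -/
theorem omegaM_fderiv_of_descent {Φ : SpaceN n m → SpaceN n m} {φ : SpaceP n m → SpaceP n m}
    {x : SpaceN n m} (hφ : DifferentiableAt ℝ φ (realization x)) (hΦ : DifferentiableAt ℝ Φ x)
    (hsymp : ∀ u v, omegaN (fderiv ℝ Φ x u) (fderiv ℝ Φ x v) = omegaN u v)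
    (h : (fun x => φ (realization x)) =ᶠ[𝓝 x] fun x => realization (Φ x))
    (hM : realization x ∈ spaceM n m) (hM' : φ (realization x) ∈ spaceM n m)
    (htan : ∀ u ∈ tangentM (realization x),
      fderiv ℝ φ (realization x) u ∈ tangentM (φ (realization x)))
    {u v : SpaceP n m} (hu : u ∈ tangentM (realization x)) (hv : v ∈ tangentM (realization x)) :
    omegaM (φ (realization x)) (fderiv ℝ φ (realization x) u) (fderiv ℝ φ (realization x) v) =
      omegaM (realization x) u v := by
  have hx : φ (realization x) = realization (Φ x) := h.self_of_nhds
  have hD : ∀ ξ, fderiv ℝ φ (realization x) (dRealization x ξ) =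
      dRealization (Φ x) (fderiv ℝ Φ x ξ) := fun ξ => by
    rw [← fderiv_realization, ← fderiv_realization]
    exact congrArg (fun L => L ξ) (fderiv_descent hφ hΦ h)
  obtain ⟨ξ, rfl⟩ := exists_dRealization_eq hM hu
  obtain ⟨η, rfl⟩ := exists_dRealization_eq hM hv
  have hu' := htan _ hu
  have hv' := htan _ hv
  rw [hD, hx] at hu' hv'
  rw [hx] at hM'
  rw [hD, hD, hx, omegaM_dRealization hM' hu' hv', omegaM_dRealization hM hu hv, hsymp]

/-! ### Existence of the integrator for small step sizes -/

/-- The local data from which the integrator is constructed: near the compact set `D` the vector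
field is bounded and Lipschitz on balls of radius `δ`. -/
theorem exists_uniform_bounds {f : SpaceN n m → SpaceN n m} {Ω D : Set (SpaceN n m)}
    (hΩ : IsOpen Ω) (hf : ContDiffOn ℝ 1 f Ω) (hD : IsCompact D) (hDΩ : D ⊆ Ω) :
    ∃ δ > 0, ∃ M ≥ 0, ∃ L ≥ 0, ∀ x ∈ D, Metric.closedBall x δ ⊆ Ω ∧
      (∀ y ∈ Metric.closedBall x δ, ‖f y‖ ≤ M ∧ ‖fderiv ℝ f y‖ ≤ L) ∧
      ∀ y ∈ Metric.closedBall x δ, ∀ y' ∈ Metric.closedBall x δ,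
        ‖f y - f y'‖ ≤ L * ‖y - y'‖ := by
  obtain ⟨δ, hδ, hsub⟩ := hD.exists_cthickening_subset_open hΩ hDΩ
  have hc : IsCompact (Metric.cthickening δ D) := hD.cthickening
  obtain ⟨M, hM⟩ := hc.exists_bound_of_continuousOn (hf.continuousOn.mono hsub)
  obtain ⟨L, hL⟩ := hc.exists_bound_of_continuousOn
    ((hf.continuousOn_fderiv_of_isOpen hΩ le_rfl).mono hsub)
  have hball : ∀ x ∈ D, Metric.closedBall x δ ⊆ Metric.cthickening δ D := fun x hx =>
    Metric.closedBall_subset_cthickening hx δ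
  refine ⟨δ, hδ, max M 0, le_max_right _ _, max L 0, le_max_right _ _, fun x hx =>
    ⟨(hball x hx).trans hsub, fun y hy => ⟨(hM y (hball x hx hy)).trans (le_max_left _ _),
      (hL y (hball x hx hy)).trans (le_max_left _ _)⟩, fun y hy y' hy' => ?_⟩⟩
  refine (convex_closedBall x δ).norm_image_sub_le_of_norm_fderiv_le (𝕜 := ℝ) (fun z hz => ?_)
    (fun z hz => (hL z (hball x hx hz)).trans (le_max_left _ _)) hy' hy
  exact (hf.contDiffAt (hΩ.mem_nhds (hsub (hball x hx hz)))).differentiableAt one_ne_zero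

theorem PRKMethod.dist_stageMap_le (T : PRKMethod s) (h : ℝ) (f : SpaceN n m → SpaceN n m)
    {L : ℝ} (hL : 0 ≤ L) (x x' : SpaceN n m) {S S' : Fin s → SpaceN n m}
    (hf : ∀ j, ‖f (S j) - f (S' j)‖ ≤ L * ‖S j - S' j‖) :
    ‖T.stageMap h f x S - T.stageMap h f x' S'‖ ≤
      ‖x - x'‖ + |h| * (‖T.stageLin (n := n) (m := m)‖ * (L * ‖S - S'‖)) := by
  have h1 : T.stageMap h f x S - T.stageMap h f x' S' =
      (fun _ => x - x') + h • T.stageLin (fun j => f (S j) - f (S' j)) := by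
    have : (fun j => f (S j) - f (S' j)) = (fun j => f (S j)) - fun j => f (S' j) := rfl
    rw [this, map_sub, smul_sub, T.stageMap_eq, T.stageMap_eq]
    ext1 i
    simp only [Pi.add_apply, Pi.sub_apply]
    abel
  rw [h1]
  refine (norm_add_le _ _).trans (add_le_add (pi_norm_const_le _) ?_)
  rw [norm_smul, Real.norm_eq_abs]
  refine mul_le_mul_of_nonneg_left ((T.stageLin.le_opNorm _).trans
    (mul_le_mul_of_nonneg_left ?_ (norm_nonneg _))) (abs_nonneg h)
  refine (pi_norm_le_iff_of_nonneg (by positivity)).2 fun j => (hf j).trans ?_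
  exact mul_le_mul_of_nonneg_left (norm_le_pi_norm (S - S') j) hL

/-- For small steps, a partitioned Runge–Kutta method defines an integrator on a compact set in
the domain of the vector field, with stages close to the initial point. -/
theorem PRKMethod.exists_isIntegrator (T : PRKMethod s) {f : SpaceN n m → SpaceN n m}
    {Ω D : Set (SpaceN n m)} (hΩ : IsOpen Ω) (hf : ContDiffOn ℝ 1 f Ω) (hD : IsCompact D)
    (hDΩ : D ⊆ Ω) {ε : ℝ} (hε : 0 < ε) :
    ∃ h₀ > 0, ∀ h : ℝ, |h| < h₀ → ∃ Y, T.IsIntegrator h f Ω D Y ∧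
      ∀ x ∈ D, ∀ i, dist (Y x i) x < ε := by
  obtain ⟨δ, hδ, M, hM, L, hL, hb⟩ := exists_uniform_bounds hΩ hf hD hDΩ
  set κ := ‖T.stageLin (n := n) (m := m)‖ with hκ
  have hκ0 : 0 ≤ κ := norm_nonneg _
  -- Half the radius: stages within `ρ` of `x'` stay within `δ` of `x` when `x'` is within `ρ` of
  -- `x`, as the continuity argument requires.
  set ρ := min δ ε / 2 with hρ
  have hρ0 : 0 < ρ := by positivity
  have hρδ : 2 * ρ ≤ δ := by rw [hρ]; linarith [min_le_left δ ε]
  have hρε : ρ < ε := by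
    have := min_le_right δ ε
    rw [hρ]; linarith
  -- The first bound keeps the stage map inside the ball of radius `ρ`, the second makes it a
  -- contraction with factor `1/2`; adding `1` avoids division by zero.
  refine ⟨min (ρ / (κ * M + 1)) (1 / (2 * (κ * L + 1))), by positivity, fun h hh => ?_⟩
  have hh1 : |h| * (κ * M) ≤ ρ := by
    have := (lt_div_iff₀ (by positivity)).1 (hh.trans_le (min_le_left _ _))
    nlinarith [abs_nonneg h]
  have hh2 : |h| * (κ * L) ≤ 1 / 2 := by
    have := (lt_div_iff₀ (by positivity)).1 (hh.trans_le (min_le_right _ _))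
    nlinarith [abs_nonneg h]
  have hmem : ∀ {x : SpaceN n m} {S : Fin s → SpaceN n m},
      S ∈ Metric.closedBall (fun _ => x) ρ → ∀ j, S j ∈ Metric.closedBall x ρ :=
    fun {x S} hS j => (dist_le_pi_dist S (fun _ => x) j).trans hS
  have hρ1 : ∀ x : SpaceN n m, Metric.closedBall x ρ ⊆ Metric.closedBall x δ := fun x =>
    Metric.closedBall_subset_closedBall (by linarith)
  have hcontr : ∀ {x x' : SpaceN n m} {S S' : Fin s → SpaceN n m},
      (∀ j, ‖f (S j) - f (S' j)‖ ≤ L * ‖S j - S' j‖) →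
      ‖T.stageMap h f x S - T.stageMap h f x' S'‖ ≤ ‖x - x'‖ + 1 / 2 * ‖S - S'‖ :=
    fun {x x' S S'} hS => (T.dist_stageMap_le h f hL x x' hS).trans
      (by nlinarith [mul_le_mul_of_nonneg_right hh2 (norm_nonneg (S - S'))])
  have hfix : ∀ x ∈ D, ∃ S ∈ Metric.closedBall (fun _ : Fin s => x) ρ, T.stageMap h f x S = S := by
    intro x hx
    obtain ⟨-, hbd, hlip⟩ := hb x hx
    have hmaps : Set.MapsTo (T.stageMap h f x) (Metric.closedBall (fun _ : Fin s => x) ρ)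
        (Metric.closedBall (fun _ : Fin s => x) ρ) := by
      intro S hS
      rw [mem_closedBall_iff_norm, T.stageMap_eq, add_sub_cancel_left, norm_smul,
        Real.norm_eq_abs]
      refine le_trans (mul_le_mul_of_nonneg_left ((T.stageLin.le_opNorm _).trans
        (mul_le_mul_of_nonneg_left ?_ hκ0)) (abs_nonneg h)) hh1
      exact (pi_norm_le_iff_of_nonneg hM).2 fun j => (hbd _ (hρ1 x (hmem hS j))).1
    have hctr : ContractingWith (1 / 2) (hmaps.restrict (T.stageMap h f x) _ _) := by
      refine ⟨by norm_num, LipschitzWith.of_dist_le_mul fun S S' => ?_⟩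
      have := hcontr (x := x) (x' := x) fun j =>
        hlip _ (hρ1 x (hmem S.2 j)) _ (hρ1 x (hmem S'.2 j))
      rw [sub_self, norm_zero, zero_add] at this
      rw [Subtype.dist_eq, Subtype.dist_eq, dist_eq_norm, dist_eq_norm]
      simpa using this
    obtain ⟨S, hS, hSfix, -⟩ := hctr.exists_fixedPoint' Metric.isClosed_closedBall.isComplete hmaps
      (Metric.mem_closedBall_self hρ0.le) (edist_ne_top _ _)
    exact ⟨S, hS, hSfix⟩
  choose! Y hYmem hYfix using hfix
  have hYx : ∀ x ∈ D, ∀ j, Y x j ∈ Metric.closedBall x ρ := fun x hx => hmem (hYmem x hx)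
  refine ⟨Y, ⟨?_, fun x hx i => (hb x hx).1 (hρ1 x (hYx x hx i)), fun x hx => (hYfix x hx).symm,
    fun x hx => ?_⟩, fun x hx i => (hYx x hx i).trans_lt hρε⟩
  · intro x hx
    rw [ContinuousWithinAt, tendsto_iff_norm_sub_tendsto_zero]
    have hlim : Tendsto (fun x' => 2 * ‖x' - x‖) (𝓝[D] x) (𝓝 0) := by
      have : ContinuousAt (fun x' => 2 * ‖x' - x‖) x := by fun_prop
      have h2 : Tendsto (fun x' => 2 * ‖x' - x‖) (𝓝 x) (𝓝 0) := by simpa using this.tendsto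
      exact h2.mono_left nhdsWithin_le_nhds
    refine squeeze_zero' (Eventually.of_forall fun _ => norm_nonneg _) ?_ hlim
    filter_upwards [self_mem_nhdsWithin, mem_nhdsWithin_of_mem_nhds (Metric.closedBall_mem_nhds x hρ0)]
      with x' hx' hdist
    -- Comparing the two fixed points gives `‖Y x' - Y x‖ ≤ 2‖x' - x‖`.
    have h1 := hcontr (x := x') (x' := x) (S := Y x') (S' := Y x) fun j => by
      refine (hb x hx).2.2 _ ?_ _ (hρ1 x (hYx x hx j))
      have h3 := hYx x' hx' j
      rw [Metric.mem_closedBall] at h3 hdist ⊢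
      linarith [dist_triangle (Y x' j) x' x]
    rw [hYfix x' hx', hYfix x hx] at h1
    linarith
  · rw [T.fderiv_sub_stageMap]
    have hd : ∀ i, DifferentiableAt ℝ f (Y x i) := fun i =>
      (hf.contDiffAt (hΩ.mem_nhds ((hb x hx).1 (hρ1 x (hYx x hx i))))).differentiableAt one_ne_zero
    -- The linearization is the identity minus a map of norm at most `1/2`.
    have hinj : Function.Injective
        (fderiv ℝ (T.residual h f) (Y x) : (Fin s → SpaceN n m) →ₗ[ℝ] (Fin s → SpaceN n m)) := by
      refine (injective_iff_map_eq_zero _).2 fun δ' hδ' => ?_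
      have h1 : δ' - h • T.stageLin (fun j => fderiv ℝ f (Y x j) (δ' j)) = 0 := by
        rw [← T.fderiv_residual h hd]; exact hδ'
      have h2 : ‖δ'‖ ≤ |h| * (κ * (L * ‖δ'‖)) := by
        conv_lhs => rw [sub_eq_zero.1 h1, norm_smul, Real.norm_eq_abs]
        refine mul_le_mul_of_nonneg_left ((T.stageLin.le_opNorm _).trans
          (mul_le_mul_of_nonneg_left ?_ hκ0)) (abs_nonneg h)
        refine (pi_norm_le_iff_of_nonneg (by positivity)).2 fun j => ?_
        refine ((fderiv ℝ f (Y x j)).le_opNorm _).trans ?_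
        exact mul_le_mul ((hb x hx).2.1 _ (hρ1 x (hYx x hx j))).2 (norm_le_pi_norm δ' j)
          (norm_nonneg _) hL
      have h3 := mul_le_mul_of_nonneg_right hh2 (norm_nonneg δ')
      have h4 : ‖δ'‖ ≤ 0 := by nlinarith
      exact norm_le_zero_iff.1 h4
    exact ⟨hinj, LinearMap.surjective_of_injective hinj⟩

theorem PRKMethod.IsIntegrator.mono {T : PRKMethod s} {h : ℝ} {f : SpaceN n m → SpaceN n m}
    {Ω V V' : Set (SpaceN n m)} {Y : SpaceN n m → Fin s → SpaceN n m}
    (hI : T.IsIntegrator h f Ω V Y) (hV : V' ⊆ V) : T.IsIntegrator h f Ω V' Y :=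
  ⟨hI.continuousOn.mono hV, fun x hx => hI.mem_domain x (hV hx),
    fun x hx => hI.stage_eq x (hV hx), fun x hx => hI.regular x (hV hx)⟩

theorem PRKMethod.exists_isIntegrator_pullback (T : PRKMethod s) {U : Set (SpaceP n m)}
    {f : SpaceN n m → SpaceN n m} (hU : IsOpen U) (hf : ContDiffOn ℝ 1 f (realization ⁻¹' U))
    {C : Set (SpaceP n m)} (hC : IsCompact C) (hCU : C ⊆ U) {ε : ℝ} (hε : 0 < ε) :
    ∃ h₀ > 0, ∀ h : ℝ, |h| < h₀ →
      ∃ (W : Set (SpaceP n m)) (Y : SpaceN n m → Fin s → SpaceN n m), IsOpen W ∧ C ⊆ W ∧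
        T.IsIntegrator h f (realization ⁻¹' U) (realization ⁻¹' W) Y ∧
        ∀ x ∈ realization ⁻¹' W, ∀ i, dist (Y x i) x < ε := by
  -- Properness of `ψ` makes the preimage of `closure W` compact, so one step-size bound serves all
  -- of it.
  obtain ⟨W, hW, hCW, hWU, hWc⟩ := exists_open_between_and_isCompact_closure hC hU hCU
  obtain ⟨h₀, hh₀, H⟩ := T.exists_isIntegrator (hU.preimage continuous_realization) hf
    (isCompact_realization_preimage hWc) (Set.preimage_mono hWU) hε
  refine ⟨h₀, hh₀, fun h hh => ?_⟩
  obtain ⟨Y, hI, hdist⟩ := H h hh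
  have hsub : realization ⁻¹' W ⊆ realization (n := n) (m := m) ⁻¹' closure W :=
    Set.preimage_mono subset_closure
  exact ⟨W, Y, hW, hCW, hI.mono hsub, fun x hx => hdist x (hsub hx)⟩

/-! ### Equivariance -/

theorem PRKMethod.stageLin_map (T : PRKMethod s) (L : SpaceN n m →ₗ[ℝ] SpaceN n m)
    (hL : ∀ α β γ v, L (scaleN α β γ v) = scaleN α β γ (L v)) (F : Fin s → SpaceN n m)
    (i : Fin s) : L (T.stageLin F i) = T.stageLin (fun j => L (F j)) i := by
  simp only [T.stageLin_apply, map_sum, hL]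

theorem PRKMethod.updateLin_map (T : PRKMethod s) (L : SpaceN n m →ₗ[ℝ] SpaceN n m)
    (hL : ∀ α β γ v, L (scaleN α β γ v) = scaleN α β γ (L v)) (F : Fin s → SpaceN n m) :
    L (T.updateLin F) = T.updateLin (fun j => L (F j)) := by
  simp only [T.updateLin_apply, map_sum, hL]

/-- A linear map which intertwines two vector fields along `S` intertwines the residuals. -/
theorem PRKMethod.residual_map (T : PRKMethod s) (h : ℝ) (L : SpaceN n m →ₗ[ℝ] SpaceN n m)
    (hL : ∀ α β γ v, L (scaleN α β γ v) = scaleN α β γ (L v))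
    {f f' : SpaceN n m → SpaceN n m} {S : Fin s → SpaceN n m}
    (hf : ∀ j, L (f (S j)) = f' (L (S j))) :
    T.residual h f' (fun j => L (S j)) = fun i => L (T.residual h f S i) := by
  funext i
  change L (S i) - h • T.stageLin (fun j => f' (L (S j))) i = L (S i - h • T.stageLin _ i)
  rw [map_sub, map_smul, T.stageLin_map L hL]
  simp only [hf]

theorem PRKMethod.update_map (T : PRKMethod s) (h : ℝ) (L : SpaceN n m →ₗ[ℝ] SpaceN n m)
    (hL : ∀ α β γ v, L (scaleN α β γ v) = scaleN α β γ (L v))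
    {f f' : SpaceN n m → SpaceN n m} {S : Fin s → SpaceN n m}
    (hf : ∀ j, L (f (S j)) = f' (L (S j))) (x : SpaceN n m) :
    T.update h f' (L x) (fun j => L (S j)) = L (T.update h f x S) := by
  rw [T.update_eq, T.update_eq, map_add, map_smul, T.updateLin_map L hL]
  simp only [hf]

/-- `f` is the lift of `g` on the preimage of `U`. -/
def IsLiftOn (f : SpaceN n m → SpaceN n m) (g : SpaceP n m → SpaceP n m)
    (U : Set (SpaceP n m)) : Prop :=
  ∀ x, realization x ∈ U → f x = liftN (g (realization x)) x

section Lift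

variable {T : PRKMethod s} {h : ℝ} {f : SpaceN n m → SpaceN n m} {g : SpaceP n m → SpaceP n m}
  {U W : Set (SpaceP n m)} {Y : SpaceN n m → Fin s → SpaceN n m}

theorem IsLiftOn.torusN_apply (hfg : IsLiftOn f g U) {a : Fin n → ℂ} (ha : ∀ j, ‖a j‖ = 1)
    {x : SpaceN n m} (hx : realization x ∈ U) : torusN a (f x) = f (torusN a x) := by
  rw [hfg x hx, torusN_liftN, hfg _ (by rwa [realization_torusN ha]), realization_torusN ha]

theorem contDiffOn_of_isLiftOn (hfg : IsLiftOn f g U) {r : WithTop ℕ∞}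
    (hg : ContDiffOn ℝ r g U) : ContDiffOn ℝ r f (realization ⁻¹' U) :=
  (contDiff_liftN.comp_contDiffOn ((hg.comp contDiff_realization.contDiffOn
    (Set.mapsTo_preimage _ _)).prodMk contDiffOn_id)).congr fun x hx => hfg x hx

/-- The stages are equivariant under the torus. -/
theorem stages_torusN (hfg : IsLiftOn f g U) (hU : IsOpen U) (hg : ContDiffOn ℝ 1 g U)
    (hI : T.IsIntegrator h f (realization ⁻¹' U) (realization ⁻¹' W) Y)
    (θ : Fin n → ℝ) {x : SpaceN n m} (hx : realization x ∈ W) (t : ℝ) :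
    Y (torusN (phases θ t) x) = fun i => torusN (phases θ t) (Y x i) := by
  have hf := contDiffOn_of_isLiftOn hfg hg
  have hV : ∀ t, torusN (phases θ t) x ∈ realization ⁻¹' W := fun t => by
    rwa [Set.mem_preimage, realization_torusN (norm_phases θ t)]
  have hc1 : Continuous fun t => Y (torusN (phases θ t) x) :=
    hI.continuousOn.comp_continuous
      (continuous_torusN.comp ((continuous_phases θ).prodMk continuous_const)) hV
  have hc2 : Continuous fun t => fun i => torusN (phases θ t) (Y x i) :=
    continuous_pi fun i =>
      continuous_torusN.comp ((continuous_phases θ).prodMk continuous_const)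
  have hres : ∀ t, T.residual h f (fun i => torusN (phases θ t) (Y x i)) =
      fun _ => torusN (phases θ t) x := fun t => by
    have h1 := T.residual_map h (torusL (phases θ t)) (torusN_scaleN (phases θ t))
      (f := f) (f' := f) (S := Y x)
      fun j => hfg.torusN_apply (norm_phases θ t) (hI.mem_domain x hx j)
    rw [hI.residual_eq hx] at h1
    exact h1
  -- Continuation along the path of phases: the set of good parameters contains `0` and is clopen in
  -- `ℝ`. It is open because the rotated stages also solve the stage equations of the rotated point,
  -- and regular solutions are locally unique.
  suffices hS : {t | Y (torusN (phases θ t) x) = fun i => torusN (phases θ t) (Y x i)} =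
      Set.univ from (Set.ext_iff.1 hS t).2 trivial
  refine IsClopen.eq_univ ⟨isClosed_eq hc1 hc2, ?_⟩ ⟨0, ?_⟩
  · refine isOpen_iff_mem_nhds.2 fun t₀ ht₀ => ?_
    refine eventuallyEq_of_comp_eq (l := 𝓝 t₀)
      (T.contDiffAt_residual h fun i => hf.contDiffAt
        ((hU.preimage continuous_realization).mem_nhds (hI.mem_domain _ (hV t₀) i)))
      (hI.bijective_fderiv_residual (hV t₀)) hc1.continuousAt ?_
      (Eventually.of_forall fun t => ?_)
    · have h2 := hc2.continuousAt (x := t₀)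
      rw [ContinuousAt, ← show Y _ = _ from ht₀] at h2
      exact h2
    · rw [hI.residual_eq (hV t), hres]
  · change Y (torusN (phases θ 0) x) = fun i => torusN (phases θ 0) (Y x i)
    simp only [torusN_phases_zero]

/-- The phase `-1` in the `j`-th factor fixes `x`, so by equivariance the `j`-th component of each
stage equals its own negative. -/
theorem stages_eq_zero (hfg : IsLiftOn f g U) (hU : IsOpen U) (hg : ContDiffOn ℝ 1 g U)
    (hI : T.IsIntegrator h f (realization ⁻¹' U) (realization ⁻¹' W) Y)
    {x : SpaceN n m} (hx : realization x ∈ W) {j : Fin n} (h1 : x.1 j = 0) (h2 : x.2.1 j = 0)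
    (i : Fin s) : (Y x i).1 j = 0 ∧ (Y x i).2.1 j = 0 := by
  have hp : ∀ k, k ≠ j → phases (Pi.single j Real.pi) 1 k = 1 := fun k hk => by
    simp [phases, hk]
  have hpj : phases (Pi.single j Real.pi) 1 j = -1 := by
    simp [phases, Complex.exp_pi_mul_I]
  have hfix : torusN (phases (Pi.single j Real.pi) 1) x = x := by
    refine Prod.ext (funext fun k => ?_) (Prod.ext (funext fun k => ?_) rfl)
    · by_cases hk : k = j
      · simp [torusN, hk, h1]
      · simp [torusN, hp k hk]
    · by_cases hk : k = j
      · simp [torusN, hk, h2]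
      · simp [torusN, hp k hk]
  have h3 := congrFun (stages_torusN hfg hU hg hI (Pi.single j Real.pi) hx 1) i
  rw [hfix] at h3
  have h4 := congrFun (congrArg Prod.fst h3) j
  have h5 := congrFun (congrArg (fun a => a.2.1) h3) j
  simp only [torusN, hpj, neg_mul, one_mul] at h4 h5
  exact ⟨self_eq_neg.1 h4, self_eq_neg.1 h5⟩

/-- The integrator maps fibres of the realization to fibres. -/
theorem realization_update_eq (hfg : IsLiftOn f g U) (hU : IsOpen U) (hg : ContDiffOn ℝ 1 g U)
    (hI : T.IsIntegrator h f (realization ⁻¹' U) (realization ⁻¹' W) Y)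
    {x x' : SpaceN n m} (hx : realization x ∈ W) (hxx' : realization x = realization x') :
    realization (T.update h f x (Y x)) = realization (T.update h f x' (Y x')) := by
  obtain ⟨θ, rfl⟩ := exists_torusN_eq hxx'
  have h1 := T.update_map h (torusL (phases θ 1)) (torusN_scaleN (phases θ 1))
    (f := f) (f' := f) (S := Y x)
    (fun j => hfg.torusN_apply (norm_phases θ 1) (hI.mem_domain x hx j)) x
  rw [stages_torusN hfg hU hg hI θ hx 1]
  change T.update h f (torusN _ x) (fun i => torusN _ (Y x i)) = torusN _ _ at h1
  rw [h1, realization_torusN (norm_phases θ 1)]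

/-! ### The reduced stage equations -/

/-- Along `δ` the coefficients are stationary to first order, so only the dependence of `liftN` on
its second argument contributes. -/
theorem fderiv_liftN {γ : SpaceN n m → SpaceP n m} {x δ : SpaceN n m}
    (hγ : DifferentiableAt ℝ γ x) (h0 : fderiv ℝ γ x δ = 0) :
    fderiv ℝ (fun a => liftN (γ a) a) x δ = liftN ((γ x).1, 0) δ := by
  have hl : Differentiable ℝ fun a : SpaceP n m × SpaceN n m => liftN a.1 a.2 :=
    contDiff_liftN.differentiable one_ne_zero
  have h1 : HasFDerivAt (fun a => liftN (γ a) a) _ x :=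
    HasFDerivAt.comp (f := fun a => (γ a, a)) x (hl (γ x, x)).hasFDerivAt
      (hγ.hasFDerivAt.prodMk (hasFDerivAt_id x))
  rw [h1.fderiv]
  change fderiv ℝ (fun a : SpaceP n m × SpaceN n m => liftN a.1 a.2) (γ x, x)
    (fderiv ℝ γ x δ, δ) = _
  rw [h0]
  refine fderiv_apply_of_quadratic (b := 0) (hl _) fun t => ?_
  simp [liftN_add_smul]

/-- The right-hand side of the reduced system: the vector field for the quaternions over the point
`y` of `P`. -/
def reducedField (g : SpaceP n m → SpaceP n m) (y : SpaceP n m) (c : SpaceN n m) : SpaceN n m :=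
  liftN (g (actP c y)) c

theorem contDiffAt_reducedField {r : WithTop ℕ∞} {y : SpaceP n m} {c : SpaceN n m}
    (hg : ContDiffAt ℝ r g (actP c y)) :
    ContDiffAt ℝ r (fun a : SpaceP n m × SpaceN n m => reducedField g a.1 a.2) (y, c) := by
  have h1 : ContDiffAt ℝ r (fun a : SpaceP n m × SpaceN n m => actP a.2 a.1) (y, c) :=
    (contDiff_actP.comp (contDiff_snd.prodMk contDiff_fst)).contDiffAt
  exact contDiff_liftN.contDiffAt.comp (y, c)
    (ContDiffAt.prodMk (ContDiffAt.comp (y, c) (g := g) hg h1) contDiffAt_snd)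

/-- For fixed `x`, the linear map `c ↦ c · x` carries the reduced field to `f`; a Runge–Kutta step
for `c` thus yields one for `c · x`. -/
theorem IsLiftOn.actN_reducedField (hfg : IsLiftOn f g U) {c x : SpaceN n m}
    (hc : realization (actN c x) ∈ U) :
    actN (reducedField g (realization x) c) x = f (actN c x) := by
  rw [hfg _ hc, reducedField, actN_liftN, realization_actN]

/-- The quaternion part of `δ` lives only over indices where `x` vanishes. There the stages vanish
too, so `dψ` annihilates `δ` and the derivative of `g ∘ ψ` drops out. -/
theorem fderiv_lift_of_actN_eq_zero (hfg : IsLiftOn f g U) (hU : IsOpen U)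
    (hg : ContDiffOn ℝ 1 g U)
    (hI : T.IsIntegrator h f (realization ⁻¹' U) (realization ⁻¹' W) Y)
    {x δ : SpaceN n m} (hx : realization x ∈ W) (hδ : actN δ x = 0) (i : Fin s) :
    fderiv ℝ f (Y x i) δ = liftN ((g (realization (Y x i))).1, 0) δ := by
  have hYU : realization (Y x i) ∈ U := hI.mem_domain x hx i
  have hgd : DifferentiableAt ℝ g (realization (Y x i)) :=
    (hg.contDiffAt (hU.mem_nhds hYU)).differentiableAt one_ne_zero
  have hψ : DifferentiableAt ℝ realization (Y x i) :=
    contDiff_realization.differentiable one_ne_zero _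
  have hev : f =ᶠ[𝓝 (Y x i)] fun a => liftN (g (realization a)) a := by
    filter_upwards [(hU.preimage continuous_realization).mem_nhds hYU] with a ha
    exact hfg a ha
  rw [hev.fderiv_eq]
  refine fderiv_liftN (γ := fun a => g (realization a)) (hgd.comp _ hψ) ?_
  have h1 : fderiv ℝ (fun a => g (realization a)) (Y x i) =
      (fderiv ℝ g (realization (Y x i))).comp (fderiv ℝ realization (Y x i)) :=
    fderiv_comp _ hgd hψ
  have h2 : dRealization (Y x i) δ = 0 := by
    obtain ⟨hz, hpq⟩ := of_actN_eq_zero hδ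
    refine Prod.ext (funext fun j => ?_) hpq
    rcases hz j with ⟨h3, h4⟩ | ⟨h3, h4⟩
    · simp [dRealization, dHopf, h3, h4]
    · obtain ⟨h5, h6⟩ := stages_eq_zero hfg hU hg hI hx h3 h4 i
      simp [dRealization, dHopf, h5, h6]
  rw [h1, ContinuousLinearMap.comp_apply, fderiv_realization, h2, map_zero]

theorem differentiableAt_actP (y : SpaceP n m) (c : SpaceN n m) :
    DifferentiableAt ℝ (fun c => actP c y) c :=
  (contDiff_actP.comp (contDiff_id.prodMk contDiff_const)).differentiable one_ne_zero c

/-- Moving `c` along `δ` does not move `c · x`, so the argument of `g` is constant. The result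
matches `fderiv_lift_of_actN_eq_zero` when `c · x` is the stage. -/
theorem fderiv_reducedField_of_actN_eq_zero {c x δ : SpaceN n m}
    (hg : DifferentiableAt ℝ g (realization (actN c x))) (hδ : actN δ x = 0) :
    fderiv ℝ (reducedField g (realization x)) c δ =
      liftN ((g (realization (actN c x))).1, 0) δ := by
  rw [realization_actN] at hg ⊢
  refine fderiv_liftN (γ := fun a => g (actP a (realization x)))
    (hg.comp c (differentiableAt_actP _ _)) ?_
  have h1 : fderiv ℝ (fun a => g (actP a (realization x))) c =
      (fderiv ℝ g (actP c (realization x))).comp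
        (fderiv ℝ (fun a => actP a (realization x)) c) :=
    fderiv_comp (f := fun a => actP a (realization x)) c hg (differentiableAt_actP _ _)
  have h2 : fderiv ℝ (fun a => actP a (realization x)) c δ = 0 := by
    refine fderiv_apply_of_quadratic (b := 0) (differentiableAt_actP _ _) fun t => ?_
    rw [← realization_actN, ← realization_actN, ← actL_apply, map_add, map_smul, actL_apply x δ,
      hδ]
    simp [actL_apply]
  rw [h1, ContinuousLinearMap.comp_apply, h2, map_zero]

/-- `actN · x`, applied to every stage. -/
def stagesActL (s : ℕ) (x : SpaceN n m) : (Fin s → SpaceN n m) →L[ℝ] (Fin s → SpaceN n m) :=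
  ContinuousLinearMap.pi fun i =>
    (actL x).comp (ContinuousLinearMap.proj (R := ℝ) (φ := fun _ => SpaceN n m) i)

theorem stagesActL_apply (x : SpaceN n m) (S : Fin s → SpaceN n m) :
    stagesActL s x S = fun i => actN (S i) x := rfl

theorem residual_stagesActL (hfg : IsLiftOn f g U) {x : SpaceN n m} {S : Fin s → SpaceN n m}
    (hS : ∀ i, realization (actN (S i) x) ∈ U) :
    T.residual h f (stagesActL s x S) =
      stagesActL s x (T.residual h (reducedField g (realization x)) S) :=
  T.residual_map h (actL x) (fun α β γ v => actN_scaleN α β γ v x)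
    fun j => hfg.actN_reducedField (hS j)

theorem fderiv_residual_of_actN_eq_zero (hfg : IsLiftOn f g U) (hU : IsOpen U)
    (hg : ContDiffOn ℝ 1 g U)
    (hI : T.IsIntegrator h f (realization ⁻¹' U) (realization ⁻¹' W) Y)
    {x : SpaceN n m} (hx : realization x ∈ W) {δ : Fin s → SpaceN n m}
    (hδ : stagesActL s x δ = 0) :
    fderiv ℝ (T.residual h f) (Y x) δ =
      δ - h • T.stageLin (fun j => liftN ((g (realization (Y x j))).1, 0) (δ j)) := by
  have hf := contDiffOn_of_isLiftOn hfg hg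
  rw [T.fderiv_residual h fun i => (hf.contDiffAt ((hU.preimage continuous_realization).mem_nhds
    (hI.mem_domain x hx i))).differentiableAt one_ne_zero]
  congr 3
  funext j
  exact fderiv_lift_of_actN_eq_zero hfg hU hg hI hx (congrFun hδ j) j

theorem liftN_zero_right (v : Fin n → Fin 3 → ℝ) :
    liftN (v, 0) (0 : SpaceN n m) = 0 := by
  refine Prod.ext (funext fun j => ?_) (Prod.ext (funext fun j => ?_) rfl) <;>
    refine Complex.ext ?_ ?_ <;> simp [liftN]

/-- On the stages annihilated by `stagesActL`, the linearized stage equations are uniquely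
solvable. -/
theorem exists_fderiv_residual_eq (hfg : IsLiftOn f g U) (hU : IsOpen U)
    (hg : ContDiffOn ℝ 1 g U)
    (hI : T.IsIntegrator h f (realization ⁻¹' U) (realization ⁻¹' W) Y)
    {x : SpaceN n m} (hx : realization x ∈ W) {e : Fin s → SpaceN n m}
    (he : stagesActL s x e = 0) :
    ∃ δ, stagesActL s x δ = 0 ∧ fderiv ℝ (T.residual h f) (Y x) δ = e := by
  let A : (Fin s → SpaceN n m) →ₗ[ℝ] (Fin s → SpaceN n m) := fderiv ℝ (T.residual h f) (Y x)
  let N : Submodule ℝ (Fin s → SpaceN n m) := LinearMap.ker (stagesActL s x).toLinearMap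
  -- The linearization preserves the kernel, and an injective endomorphism of this
  -- finite-dimensional space is onto.
  have hA : ∀ δ ∈ N, A δ ∈ N := by
    intro δ hδ
    have hδ' : stagesActL s x δ = 0 := hδ
    change stagesActL s x (fderiv ℝ (T.residual h f) (Y x) δ) = 0
    rw [fderiv_residual_of_actN_eq_zero hfg hU hg hI hx hδ', map_sub, map_smul, hδ', zero_sub,
      neg_eq_zero]
    have h1 : stagesActL s x
        (T.stageLin fun j => liftN ((g (realization (Y x j))).1, 0) (δ j)) = 0 := by
      funext i
      rw [stagesActL_apply]
      change (actL x).toLinearMap _ = _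
      rw [T.stageLin_map (actL x).toLinearMap (fun α β γ v => actN_scaleN α β γ v x)]
      have h2 : (fun j => (actL x).toLinearMap
          (liftN ((g (realization (Y x j))).1, 0) (δ j))) = 0 := by
        funext j
        change actN _ x = 0
        rw [actN_liftN, show actN (δ j) x = 0 from congrFun hδ' j, liftN_zero_right]
      rw [h2, map_zero]
    rw [h1, smul_zero]
  have hinj : Function.Injective (A.restrict hA) := fun a b hab => Subtype.ext
    ((hI.bijective_fderiv_residual hx).1 (congrArg Subtype.val hab))
  obtain ⟨δ, hδ⟩ := LinearMap.surjective_of_injective hinj ⟨e, he⟩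
  exact ⟨δ, δ.2, congrArg Subtype.val hδ⟩

/-- A regular solution of the stage equations comes from a regular solution of the reduced stage
equations. -/
theorem exists_reduced_stages (hfg : IsLiftOn f g U) (hU : IsOpen U)
    (hg : ContDiffOn ℝ 1 g U)
    (hI : T.IsIntegrator h f (realization ⁻¹' U) (realization ⁻¹' W) Y)
    {x : SpaceN n m} (hx : realization x ∈ W) :
    ∃ c : Fin s → SpaceN n m, stagesActL s x c = Y x ∧
      T.residual h (reducedField g (realization x)) c = (fun _ => unitN (realization x)) ∧
      Function.Bijective (fderiv ℝ (T.residual h (reducedField g (realization x))) c) := by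
  have hf := contDiffOn_of_isLiftOn hfg hg
  have hYU : ∀ i, realization (Y x i) ∈ U := hI.mem_domain x hx
  choose c₁ hc₁ using fun i => exists_actN_eq (x := x) (y := Y x i) fun j h1 h2 =>
    stages_eq_zero hfg hU hg hI hx h1 h2 i
  have hc₁' : stagesActL s x c₁ = Y x := funext hc₁
  -- An arbitrary choice of quotients `c₁` solves the reduced equations only after acting on `x`.
  -- The defect lies in the kernel of that action and is removed by a correction `δ` in the same
  -- kernel.
  obtain ⟨δ, hδ, hδe⟩ := exists_fderiv_residual_eq hfg hU hg hI hx
    (e := (fun _ => unitN (realization x)) - T.residual h (reducedField g (realization x)) c₁) (by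
      rw [map_sub, ← residual_stagesActL hfg fun i => by rw [hc₁]; exact hYU i, hc₁',
        hI.residual_eq hx, stagesActL_apply]
      simp only [actN_unitN]
      exact sub_self _)
  have hc : stagesActL s x (c₁ + δ) = Y x := by rw [map_add, hc₁', hδ, add_zero]
  refine ⟨c₁ + δ, hc, ?_, ?_⟩
  · rw [fderiv_residual_of_actN_eq_zero hfg hU hg hI hx hδ, eq_sub_iff_add_eq] at hδe
    rw [← hδe]
    -- The linear correction is exact: adding `δ` leaves the argument of `g` unchanged, and `liftN`
    -- is affine in its second argument.
    have h1 : (fun j => reducedField g (realization x) ((c₁ + δ) j)) =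
        (fun j => reducedField g (realization x) (c₁ j)) +
          fun j => liftN ((g (realization (Y x j))).1, 0) (δ j) := by
      funext j
      have h2 := liftN_add_smul (g (realization (Y x j))) (c₁ j) (δ j) 1
      rw [one_smul, one_smul] at h2
      change reducedField g (realization x) (c₁ j + δ j) = reducedField g (realization x) (c₁ j) + _
      rw [reducedField, reducedField, ← realization_actN, ← realization_actN,
        show actN (c₁ j + δ j) x = Y x j from congrFun hc j, hc₁, h2]
    rw [PRKMethod.residual, PRKMethod.residual, h1, map_add, smul_add]
    abel
  · have hgc : ∀ i, ContDiffAt ℝ 1 g (realization (actN ((c₁ + δ) i) x)) := fun i => by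
      rw [show actN ((c₁ + δ) i) x = Y x i from congrFun hc i]
      exact hg.contDiffAt (hU.mem_nhds (hYU i))
    have hFc : ∀ i, ContDiffAt ℝ 1 (reducedField g (realization x)) ((c₁ + δ) i) := fun i =>
      ContDiffAt.comp (f := fun c => (realization x, c)) ((c₁ + δ) i)
        (contDiffAt_reducedField (by rw [← realization_actN]; exact hgc i))
        (contDiffAt_const.prodMk contDiffAt_id)
    have hRd : DifferentiableAt ℝ (T.residual h (reducedField g (realization x))) (c₁ + δ) :=
      (T.contDiffAt_residual h hFc).differentiableAt one_ne_zero
    -- Acting on `x` sends a null vector `δ'` to a null vector of the original linearization, so `δ'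
    -- · x = 0`. On such directions both linearizations agree, so `δ' = 0`.
    have hinj : Function.Injective (fderiv ℝ (T.residual h (reducedField g (realization x)))
        (c₁ + δ) : (Fin s → SpaceN n m) →ₗ[ℝ] (Fin s → SpaceN n m)) := by
      refine (injective_iff_map_eq_zero _).2 fun δ' hδ' => ?_
      have hδ'' : fderiv ℝ (T.residual h (reducedField g (realization x))) (c₁ + δ) δ' = 0 := hδ'
      have hev : (fun S => T.residual h f (stagesActL s x S)) =ᶠ[𝓝 (c₁ + δ)]
          fun S => stagesActL s x (T.residual h (reducedField g (realization x)) S) := by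
        have h1 : ∀ᶠ S in 𝓝 (c₁ + δ), ∀ i, realization (stagesActL s x S i) ∈ U := by
          refine eventually_all.2 fun i => ?_
          have h2 : ContinuousAt (fun S => realization (stagesActL s x S i)) (c₁ + δ) :=
            (continuous_realization.comp
              ((continuous_apply i).comp (stagesActL s x).continuous)).continuousAt
          refine h2.eventually (hU.mem_nhds ?_)
          beta_reduce
          rw [hc]
          exact hYU i
        filter_upwards [h1] with S hS
        exact residual_stagesActL hfg hS
      have hrf : DifferentiableAt ℝ (T.residual h f) (stagesActL s x (c₁ + δ)) := by
        rw [hc]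
        exact (T.contDiffAt_residual h fun i => hf.contDiffAt
          ((hU.preimage continuous_realization).mem_nhds (hYU i))).differentiableAt one_ne_zero
      have h1 := (hrf.hasFDerivAt.comp (c₁ + δ) (stagesActL s x).hasFDerivAt).congr_of_eventuallyEq
        hev.symm
      have h2 := congrArg (fun L => L δ')
        (h1.unique ((stagesActL s x).hasFDerivAt.comp (c₁ + δ) hRd.hasFDerivAt))
      simp only [ContinuousLinearMap.comp_apply, hδ'', map_zero, hc] at h2
      have h3 : stagesActL s x δ' = 0 :=
        (hI.bijective_fderiv_residual hx).1 (h2.trans (map_zero _).symm)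
      refine (hI.bijective_fderiv_residual hx).1 (Eq.trans ?_ (map_zero _).symm)
      rw [fderiv_residual_of_actN_eq_zero hfg hU hg hI hx h3, ← hδ'', T.fderiv_residual h
        fun i => (hFc i).differentiableAt one_ne_zero]
      congr 3
      funext j
      rw [fderiv_reducedField_of_actN_eq_zero ((hgc j).differentiableAt one_ne_zero)
          (δ := δ' j) (congrFun h3 j),
        show actN ((c₁ + δ) j) x = Y x j from congrFun hc j]
    exact ⟨hinj, LinearMap.surjective_of_injective hinj⟩

end Lift

/-! ### The descended integrator -/

section Descended

variable {T : PRKMethod s} {h : ℝ} {f : SpaceN n m → SpaceN n m} {g : SpaceP n m → SpaceP n m}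
  {U W : Set (SpaceP n m)} {Y : SpaceN n m → Fin s → SpaceN n m}

theorem contDiff_unitN {r : WithTop ℕ∞} : ContDiff ℝ r (unitN (n := n) (m := m)) := by
  unfold unitN
  fun_prop

theorem contDiffAt_reducedField_stages {r : WithTop ℕ∞} {y : SpaceP n m}
    {c : Fin s → SpaceN n m} (hg : ∀ i, ContDiffAt ℝ r g (actP (c i) y)) :
    ContDiffAt ℝ r (fun a : SpaceP n m × (Fin s → SpaceN n m) =>
      fun j => reducedField g a.1 (a.2 j)) (y, c) :=
  contDiffAt_pi.2 fun j =>
    ContDiffAt.comp (f := fun a : SpaceP n m × (Fin s → SpaceN n m) => (a.1, a.2 j)) (y, c)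
      (contDiffAt_reducedField (hg j))
      (contDiffAt_fst.prodMk ((contDiff_apply ℝ (SpaceN n m) j).contDiffAt.comp (y, c)
        contDiffAt_snd))

/-- The solution of the reduced stage equations is a smooth function of the point of `P`. -/
theorem exists_contDiffAt_reduced_stages {r : WithTop ℕ∞} (hr : r ≠ 0) {y : SpaceP n m}
    {c₀ : Fin s → SpaceN n m} (hg : ∀ i, ContDiffAt ℝ r g (actP (c₀ i) y))
    (heq : T.residual h (reducedField g y) c₀ = fun _ => unitN y)
    (hbij : Function.Bijective (fderiv ℝ (T.residual h (reducedField g y)) c₀)) :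
    ∃ c : SpaceP n m → Fin s → SpaceN n m, c y = c₀ ∧ ContDiffAt ℝ r c y ∧
      ∀ᶠ y' in 𝓝 y, T.residual h (reducedField g y') (c y') = fun _ => unitN y' := by
  let G : SpaceP n m × (Fin s → SpaceN n m) → Fin s → SpaceN n m :=
    fun a => T.residual h (reducedField g a.1) a.2 - fun _ => unitN a.1
  have hG : ContDiffAt ℝ r G (y, c₀) :=
    (contDiffAt_snd.sub ((T.stageLin.contDiff.contDiffAt.comp (y, c₀)
      (contDiffAt_reducedField_stages hg)).const_smul h)).sub
      (contDiffAt_pi.2 fun _ => contDiff_unitN.contDiffAt.comp (y, c₀) contDiffAt_fst)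
  have hG' : (fderiv ℝ G (y, c₀)).comp (ContinuousLinearMap.inr ℝ _ _) =
      fderiv ℝ (T.residual h (reducedField g y)) c₀ := by
    have h1 : HasFDerivAt (fun c => G (y, c))
        ((fderiv ℝ G (y, c₀)).comp (ContinuousLinearMap.inr ℝ _ _)) c₀ :=
      (hG.differentiableAt hr).hasFDerivAt.comp c₀ (hasFDerivAt_prodMk_right y c₀)
    rw [← h1.fderiv]
    exact fderiv_sub_const (f := T.residual h (reducedField g y)) (x := c₀) (fun _ => unitN y)
  have hinv : ((fderiv ℝ G (y, c₀)).comp (ContinuousLinearMap.inr ℝ _ _)).IsInvertible := by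
    rw [hG']
    exact isInvertible_of_bijective hbij
  refine ⟨hG.implicitFunction hr hinv, hG.implicitFunction_apply_self hr hinv,
    hG.contDiffAt_implicitFunction hr hinv, ?_⟩
  filter_upwards [hG.eventually_apply_implicitFunction hr hinv] with y' hy'
  have h0 : G (y, c₀) = 0 := sub_eq_zero.2 heq
  rw [h0] at hy'
  exact sub_eq_zero.1 hy'

/-- Locally, the image of the integrator in `P` is a smooth function of the point of `P`. -/
theorem exists_contDiffAt_eventually_realization_update (hfg : IsLiftOn f g U) (hU : IsOpen U)
    {r : WithTop ℕ∞} (hr : 1 ≤ r) (hg : ContDiffOn ℝ r g U) (hW : IsOpen W)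
    (hI : T.IsIntegrator h f (realization ⁻¹' U) (realization ⁻¹' W) Y)
    {x : SpaceN n m} (hx : realization x ∈ W) :
    ∃ κ : SpaceP n m → SpaceP n m, ContDiffAt ℝ r κ (realization x) ∧
      ∀ᶠ x' in 𝓝 x, realization (T.update h f x' (Y x')) = κ (realization x') := by
  have hr0 : r ≠ 0 := (zero_lt_one.trans_le hr).ne'
  have hg1 : ContDiffOn ℝ 1 g U := hg.of_le hr
  have hYU : ∀ i, realization (Y x i) ∈ U := hI.mem_domain x hx
  obtain ⟨c₀, hc₀, heq, hbij⟩ := exists_reduced_stages hfg hU hg1 hI hx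
  have hgc : ∀ i, ContDiffAt ℝ r g (actP (c₀ i) (realization x)) := fun i => by
    rw [← realization_actN, show actN (c₀ i) x = Y x i from congrFun hc₀ i]
    exact hg.contDiffAt (hU.mem_nhds (hYU i))
  obtain ⟨c, hcx, hc, hceq⟩ := exists_contDiffAt_reduced_stages hr0 hgc heq hbij
  have hcψ : ContinuousAt (fun x' => c (realization x')) x :=
    ContinuousAt.comp (g := c) hc.continuousAt continuous_realization.continuousAt
  have hS : ContinuousAt (fun x' => stagesActL s x' (c (realization x'))) x :=
    continuousAt_pi.2 fun i => (continuous_actN.continuousAt (x := (c (realization x) i, x))).comp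
      (f := fun x' => (c (realization x') i, x'))
      ((continuousAt_pi.1 hcψ i).prodMk continuousAt_id)
  have hSx : stagesActL s x (c (realization x)) = Y x := by rw [hcx, hc₀]
  have hSU : ∀ᶠ x' in 𝓝 x, ∀ i, realization (actN (c (realization x') i) x') ∈ U := by
    refine eventually_all.2 fun i => ?_
    refine (continuous_realization.continuousAt.comp (continuousAt_pi.1 hS i)).eventually
      (hU.mem_nhds ?_)
    change realization (stagesActL s x (c (realization x)) i) ∈ U
    rw [hSx]
    exact hYU i
  have hxW : ∀ᶠ x' in 𝓝 x, realization x' ∈ W :=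
    continuous_realization.continuousAt.eventually (hW.mem_nhds hx)
  -- Both sides are continuous solutions of the same regular equations and agree at `x`, hence agree
  -- nearby.
  have hYS : Y =ᶠ[𝓝 x] fun x' => stagesActL s x' (c (realization x')) := by
    refine eventuallyEq_of_comp_eq
      (T.contDiffAt_residual h fun i => (contDiffOn_of_isLiftOn hfg hg1).contDiffAt
        ((hU.preimage continuous_realization).mem_nhds (hYU i)))
      (hI.bijective_fderiv_residual hx)
      (hI.continuousOn.continuousAt ((hW.preimage continuous_realization).mem_nhds hx)) ?_ ?_
    · have h4 := hS.tendsto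
      rw [hSx] at h4
      exact h4
    · filter_upwards [hSU, hxW, continuous_realization.continuousAt.eventually hceq]
        with x' h1 h2 h3
      rw [hI.residual_eq h2, residual_stagesActL hfg h1, h3, stagesActL_apply]
      simp only [actN_unitN]
  -- The method is run on the quaternions from the identity over `y`; the resulting quaternion then
  -- acts on `y`. This expression no longer refers to `x`.
  refine ⟨fun y => actP (T.update h (reducedField g y) (unitN y) (c y)) y, ?_, ?_⟩
  · have h1 : ContDiffAt ℝ r (fun y => fun j => reducedField g y (c y j)) (realization x) :=
      ContDiffAt.comp (f := fun y => (y, c y)) (realization x)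
        (contDiffAt_reducedField_stages (by rw [hcx]; exact hgc)) (contDiffAt_id.prodMk hc)
    have h2 : ContDiffAt ℝ r (fun y => T.update h (reducedField g y) (unitN y) (c y))
        (realization x) := by
      simp only [T.update_eq]
      exact contDiff_unitN.contDiffAt.add
        ((T.updateLin.contDiff.contDiffAt.comp (realization x) h1).const_smul h)
    exact ContDiffAt.comp (g := fun a : SpaceN n m × SpaceP n m => actP a.1 a.2)
      (f := fun y => (T.update h (reducedField g y) (unitN y) (c y), y)) (realization x)
      contDiff_actP.contDiffAt (h2.prodMk contDiffAt_id)
  · filter_upwards [hSU, hYS] with x' h1 h2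
    have h3 := T.update_map h (actL x').toLinearMap (fun α β γ v => actN_scaleN α β γ v x')
      (fun j => hfg.actN_reducedField (h1 j)) (unitN (realization x'))
    change T.update h f (actN _ x') (stagesActL s x' (c (realization x'))) = actN _ x' at h3
    rw [actN_unitN, ← h2] at h3
    rw [h3, realization_actN]

/-- A method with a symplectic tableau for the `z`-component preserves the norms of the
`z`-components. -/
theorem normSq_update (hz : T.tz.IsSymplectic) (hb : ∀ i, T.tz.b i = T.tq.b i)
    (hfg : IsLiftOn f g U)
    (hI : T.IsIntegrator h f (realization ⁻¹' U) (realization ⁻¹' W) Y)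
    {x : SpaceN n m} (hx : realization x ∈ W) (j : Fin n) :
    Complex.normSq ((T.update h f x (Y x)).1 j) + Complex.normSq ((T.update h f x (Y x)).2.1 j) =
      Complex.normSq (x.1 j) + Complex.normSq (x.2.1 j) := by
  -- The form `|z₁ʲ|² + |z₂ʲ|²` is a sum of squares of real coordinates, so it obeys the product
  -- rule.
  have hL := ((PRKMethod.Leibniz.mul_coordZ₁ (m := m) hz hb Complex.reLm Complex.reLm j).add
    (PRKMethod.Leibniz.mul_coordZ₁ hz hb Complex.imLm Complex.imLm j)).add
    ((PRKMethod.Leibniz.mul_coordZ₂ hz hb Complex.reLm Complex.reLm j).add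
    (PRKMethod.Leibniz.mul_coordZ₂ hz hb Complex.imLm Complex.imLm j))
  have hst : ∀ i, Y x i = x + h • T.stageLin (fun j => f (Y x j)) i :=
    fun i => congrFun (hI.stage_eq x hx) i
  have h1 := hL h x x (fun j => f (Y x j)) (fun j => f (Y x j)) (Y x) (Y x) hst hst
  rw [Finset.sum_eq_zero, mul_zero, add_zero] at h1
  · simp only [Complex.normSq_apply]
    exact h1
  · intro i _
    -- An imaginary quaternion times `z` is orthogonal to `z`, so the contribution of every stage
    -- vanishes.
    rw [hfg (Y x i) (hI.mem_domain x hx i)]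
    simp [liftN]
    ring_nf
    simp

theorem dotProduct_realization_update (hz : T.tz.IsSymplectic) (hb : ∀ i, T.tz.b i = T.tq.b i)
    (hfg : IsLiftOn f g U)
    (hI : T.IsIntegrator h f (realization ⁻¹' U) (realization ⁻¹' W) Y)
    {x : SpaceN n m} (hx : realization x ∈ W) (j : Fin n) :
    (realization (T.update h f x (Y x))).1 j ⬝ᵥ (realization (T.update h f x (Y x))).1 j =
      (realization x).1 j ⬝ᵥ (realization x).1 j := by
  change hopf _ _ ⬝ᵥ hopf _ _ = hopf _ _ ⬝ᵥ hopf _ _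
  rw [hopf_dotProduct_self, hopf_dotProduct_self, normSq_update hz hb hfg hI hx j]

end Descended

end CollectiveSymplectic

end

/-! ### Assembly of the main theorem -/

theorem mainTheorem1 (n m s : ℕ) (T : PRKMethod s)
    (hz : T.tz.IsSymplectic) (hpq : IsSymplecticPair T.tp T.tq)
    (hb : ∀ i, T.tz.b i = T.tq.b i) (r : ℕ∞) (hr : 1 ≤ r) :
    -- the integrator is symplectic on `N`
    (∀ (Ω : Set (SpaceN n m)) (K : SpaceN n m → ℝ),
      IsOpen Ω → ContDiffOn ℝ ((r : WithTop ℕ∞) + 1) K Ω →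
      ∀ (h : ℝ) (V : Set (SpaceN n m)) (Y : SpaceN n m → Fin s → SpaceN n m),
        IsOpen V → T.IsIntegrator h (hamVectorField K) Ω V Y →
        ContDiffOn ℝ (r : WithTop ℕ∞) (fun x => T.update h (hamVectorField K) x (Y x)) V ∧
        IsSymplecticOnN (fun x => T.update h (hamVectorField K) x (Y x)) V) ∧
    -- for the pull-back of a Hamiltonian on `P`:
    (∀ (U : Set (SpaceP n m)) (H : SpaceP n m → ℝ),
      IsOpen U → ContDiffOn ℝ ((r : WithTop ℕ∞) + 1) H U →
      -- the integrator exists near compact sets if the step is small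
      (∀ C : Set (SpaceP n m), IsCompact C → C ⊆ U → ∀ ε > 0, ∃ h₀ > 0, ∀ h : ℝ, |h| < h₀ →
        ∃ (W : Set (SpaceP n m)) (Y : SpaceN n m → Fin s → SpaceN n m),
          IsOpen W ∧ C ⊆ W ∧
          T.IsIntegrator h (hamVectorField (H ∘ realization))
            (realization ⁻¹' U) (realization ⁻¹' W) Y ∧
          ∀ x ∈ realization ⁻¹' W, ∀ i, dist (Y x i) x < ε) ∧
      -- it descends to a Poisson integrator on `P`, which restricts to a symplectic one on `M`
      (∀ (h : ℝ) (W : Set (SpaceP n m)) (Y : SpaceN n m → Fin s → SpaceN n m),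
        IsOpen W →
        T.IsIntegrator h (hamVectorField (H ∘ realization))
          (realization ⁻¹' U) (realization ⁻¹' W) Y →
        ∃ φ : SpaceP n m → SpaceP n m,
          (∀ x ∈ realization ⁻¹' W, φ (realization x) =
            realization (T.update h (hamVectorField (H ∘ realization)) x (Y x))) ∧
          ContDiffOn ℝ (r : WithTop ℕ∞) φ W ∧
          IsPoissonOnP φ W ∧ PreservesLeavesOn φ W ∧ RestrictsToSymplecticOnM φ W)) := by
  have hr1 : (1 : WithTop ℕ∞) ≤ r := by exact_mod_cast hr
  have hr0 : (r : WithTop ℕ∞) ≠ 0 := (zero_lt_one.trans_le hr1).ne'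
  have hr2 : (2 : WithTop ℕ∞) ≤ (r : WithTop ℕ∞) + 1 := by
    rw [← one_add_one_eq_two]
    exact add_le_add_left hr1 1
  refine ⟨fun Ω K hΩ hK h V Y hV hI => ?_, fun U H hU hH => ?_⟩
  · exact ⟨fun x hx => (hI.contDiffAt_update hΩ hV hr0
      (contDiffOn_hamVectorField hΩ hK) hx).contDiffWithinAt,
      hI.isSymplecticOnN hz hpq hb hΩ (hK.of_le hr2) hV⟩
  have hΩ : IsOpen (realization (n := n) (m := m) ⁻¹' U) := hU.preimage continuous_realization
  have hK : ContDiffOn ℝ ((r : WithTop ℕ∞) + 1) (H ∘ realization)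
      (realization (n := n) (m := m) ⁻¹' U) :=
    hH.comp contDiff_realization.contDiffOn (Set.mapsTo_preimage _ _)
  refine ⟨fun C hC hCU ε hε => T.exists_isIntegrator_pullback hU
    ((contDiffOn_hamVectorField hΩ hK).of_le hr1) hC hCU hε, fun h W Y hW hI => ?_⟩
  have hg : ContDiffOn ℝ (r : WithTop ℕ∞) (fun y => coeffP (fderiv ℝ H y)) U :=
    coeffP.contDiff.comp_contDiffOn (hH.fderiv_of_isOpen hU le_rfl)
  have hfg : IsLiftOn (hamVectorField (H ∘ realization)) (fun y => coeffP (fderiv ℝ H y)) U :=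
    fun x hx => hamVectorField_comp_realization
      ((hH.contDiffAt (hU.mem_nhds hx)).differentiableAt
        (zero_lt_two.trans_le hr2).ne')
  set f := hamVectorField (H ∘ realization) with hf
  have hV : IsOpen (realization (n := n) (m := m) ⁻¹' W) := hW.preimage continuous_realization
  -- Any preimage of `y` may be used, since over `W` the image does not depend on it.
  let φ : SpaceP n m → SpaceP n m := fun y =>
    realization (T.update h f (Function.surjInv realization_surjective y)
      (Y (Function.surjInv realization_surjective y)))
  have hφ : ∀ x ∈ realization ⁻¹' W, φ (realization x) = realization (T.update h f x (Y x)) :=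
    fun x hx => (realization_update_eq hfg hU (hg.of_le hr1) hI hx
      (Function.surjInv_eq realization_surjective (realization x)).symm).symm
  have hev : ∀ x ∈ realization ⁻¹' W, (fun x => φ (realization x)) =ᶠ[nhds x]
      fun x => realization (T.update h f x (Y x)) := fun x hx => by
    filter_upwards [hV.mem_nhds hx] with x' hx' using hφ x' hx'
  have hφC : ∀ y ∈ W, ContDiffAt ℝ (r : WithTop ℕ∞) φ y := by
    intro y hy
    obtain ⟨x, rfl⟩ := realization_surjective y
    obtain ⟨κ, hκ, hκφ⟩ := exists_contDiffAt_eventually_realization_update hfg hU hr1 hg hW hI hy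
    -- Agreement of `φ ∘ ψ` and `κ ∘ ψ` near `x` becomes agreement of `φ` and `κ` near `ψ(x)`
    -- because `ψ` is open.
    refine hκ.congr_of_eventuallyEq (Filter.Eventually.filter_mono
      (isOpenMap_realization.nhds_le x) (Filter.eventually_map.2 ?_))
    filter_upwards [hev x hy, hκφ] with x' h1 h2
    rw [h1, h2]
  have hφD : ∀ y ∈ W, DifferentiableAt ℝ φ y := fun y hy => (hφC y hy).differentiableAt hr0
  have hsymp := hI.isSymplecticOnN hz hpq hb hΩ (hK.of_le hr2) hV
  have hleaf : PreservesLeavesOn φ W := by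
    intro y hy j
    obtain ⟨x, rfl⟩ := realization_surjective y
    rw [hφ x hy]
    exact dotProduct_realization_update hz hb hfg hI hy j
  refine ⟨φ, hφ, fun y hy => (hφC y hy).contDiffWithinAt, fun y hy => ⟨hφD y hy, ?_⟩, hleaf, ?_⟩
  · intro a b ha hb'
    obtain ⟨x, rfl⟩ := realization_surjective y
    exact poissonBracket_comp_of_descent (hφD _ hy) (hsymp x hy).1 (hsymp x hy).2 (hev x hy) ha hb'
  · rintro y ⟨hM, hy⟩
    have hM' : φ y ∈ spaceM n m := fun j => (hleaf y hy j).trans (hM j)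
    have htan : ∀ u ∈ tangentM y, fderiv ℝ φ y u ∈ tangentM (φ y) := fun u hu =>
      fderiv_mem_tangentM (hφD y hy) (by filter_upwards [hW.mem_nhds hy] using hleaf) hu
    refine ⟨hM', hφD y hy, htan, fun u hu v hv => ?_⟩
    obtain ⟨x, rfl⟩ := realization_surjective y
    exact omegaM_fderiv_of_descent (hφD _ hy) (hsymp x hy).1 (hsymp x hy).2 (hev x hy) hM hM' htan
      hu hv
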